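/- Let $K$ be a field of characteristic zero and let $A_1=A_1(K)=K\langle X,Y\mid YX-XY=1\rangle$ be the first Weyl algebra. An involution on $A_1$ is a $K$-linear map $\gamma:A_1\to A_1$ with $\gamma(1)=1$, $\gamma(ab)=\gamma(b)\gamma(a)$ for all $a,b\in A_1$ and $\gamma\circ\gamma=\mathrm{id}$. Let $\alpha$ be the exchange involution, $\alpha(X)=Y$, $\alpha(Y)=X$. Assume that every involution $\gamma$ on $A_1$ is conjugate to $\alpha$, i.e. $\gamma=g^{-1}\circ\alpha\circ g$ for some $K$-algebra automorphism or anti-automorphism $g$ of $A_1$. Then: (1) For any two involutions $\gamma,\delta$ on $A_1$, every $K$-algebra endomorphism $f$ of $A_1$ with $f\circ\gamma=\delta\circ f$ (that is, every endomorphism from the ring with involution $(A_1,\gamma)$ to the ring with involution $(A_1,\delta)$) is an automorphism of $A_1$. (2) The following two statements are equivalent: (a) (Dixmier conjecture for $A_1(K)$) every $K$-algebra endomorphism of $A_1$ is an automorphism; (b) ($\gamma,\delta$ conjecture for $A_1(K)$) for every $K$-algebra endomorphism $f$ of $A_1$ there exist involutions $\gamma,\delta$ on $A_1$ such that $f\circ\gamma=\delta\circ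 f$. -/

import Mathlib

/-- The defining relation `Y X = X Y + 1` of the first Weyl algebra; the free generators `X`, `Y`
are indexed by `0`, `1`. -/
inductive WeylRel (K : Type*) [Field K] :
    FreeAlgebra K (Fin 2) → FreeAlgebra K (Fin 2) → Prop
  | comm : WeylRel K (FreeAlgebra.ι K 1 * FreeAlgebra.ι K 0)
      (FreeAlgebra.ι K 0 * FreeAlgebra.ι K 1 + 1)

/-- The first Weyl algebra `A₁(K) = K⟨X, Y | Y X - X Y = 1⟩`. -/
abbrev WeylAlgebra (K : Type*) [Field K] : Type _ := RingQuot (WeylRel K)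

namespace WeylAlgebra

/-- The generator `X`. -/
noncomputable def X (K : Type*) [Field K] : WeylAlgebra K :=
  RingQuot.mkAlgHom K (WeylRel K) (FreeAlgebra.ι K 0)

/-- The generator `Y`. -/
noncomputable def Y (K : Type*) [Field K] : WeylAlgebra K :=
  RingQuot.mkAlgHom K (WeylRel K) (FreeAlgebra.ι K 1)

theorem Y_mul_X (K : Type*) [Field K] : Y K * X K = X K * Y K + 1 := by
  simpa [X, Y] using RingQuot.mkAlgHom_rel K (WeylRel.comm (K := K))

/-- The algebra homomorphism `A₁ → A₁ᵐᵒᵖ` with `X ↦ Y` and `Y ↦ X`. -/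
noncomputable def alphaOp (K : Type*) [Field K] : WeylAlgebra K →ₐ[K] (WeylAlgebra K)ᵐᵒᵖ :=
  RingQuot.liftAlgHom K
    ⟨FreeAlgebra.lift K ![MulOpposite.op (Y K), MulOpposite.op (X K)], by
      rintro _ _ ⟨⟩
      simp [← MulOpposite.op_mul, ← MulOpposite.op_one, ← MulOpposite.op_add, Y_mul_X]⟩

/-- The exchange involution `α` of `A₁`: the `K`-linear multiplication-reversing map with
`α X = Y` and `α Y = X`. -/
noncomputable def alpha (K : Type*) [Field K] : WeylAlgebra K →ₗ[K] WeylAlgebra K :=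
  (MulOpposite.opLinearEquiv K).symm.toLinearMap ∘ₗ (alphaOp K).toLinearMap

theorem alpha_X (K : Type*) [Field K] : alpha K (X K) = Y K := by
  simp [alpha, alphaOp, X]

theorem alpha_Y (K : Type*) [Field K] : alpha K (Y K) = X K := by
  simp [alpha, alphaOp, Y]

/-- An involution on `A₁`: a `K`-linear anti-automorphism `γ` with `γ ∘ γ = id`. -/
structure IsInvolution {K : Type*} [Field K] (γ : WeylAlgebra K →ₗ[K] WeylAlgebra K) : Prop where
  map_one : γ 1 = 1
  map_mul_rev : ∀ a b, γ (a * b) = γ b * γ a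
  involutive : ∀ a, γ (γ a) = a

/-- `γ` is conjugate to `α`: `γ = g⁻¹ ∘ α ∘ g`, where `g` is an automorphism of `A₁` or
an anti-automorphism of `A₁` (that is, an isomorphism of algebras from `A₁` onto `A₁ᵐᵒᵖ`). -/
def IsConjugateToAlpha {K : Type*} [Field K] (γ : WeylAlgebra K →ₗ[K] WeylAlgebra K) : Prop :=
  (∃ g : WeylAlgebra K ≃ₐ[K] WeylAlgebra K, ∀ a, γ a = g.symm (alpha K (g a))) ∨
  (∃ g : WeylAlgebra K ≃ₐ[K] (WeylAlgebra K)ᵐᵒᵖ,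
    ∀ a, γ a = g.symm (MulOpposite.op (alpha K (MulOpposite.unop (g a)))))

/-- The algebra endomorphism `f` of `A₁` is an endomorphism from the ring with involution
`(A₁, γ)` to the ring with involution `(A₁, δ)`: `f ∘ γ = δ ∘ f`. -/
def IsInvolutiveEndomorphism {K : Type*} [Field K] (γ δ : WeylAlgebra K →ₗ[K] WeylAlgebra K)
    (f : WeylAlgebra K →ₐ[K] WeylAlgebra K) : Prop :=
  ∀ a, f (γ a) = δ (f a)

/-- The Dixmier conjecture for `A₁(K)`: every algebra endomorphism is an automorphism. -/
def DixmierConjecture (K : Type*) [Field K] : Prop :=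
  ∀ f : WeylAlgebra K →ₐ[K] WeylAlgebra K, Function.Bijective f

/-- The `γ, δ` conjecture: for every algebra endomorphism `f` of `A₁(K)` there are involutions
`γ`, `δ` such that `f ∘ γ = δ ∘ f`. -/
def GammaDeltaConjecture (K : Type*) [Field K] : Prop :=
  ∀ f : WeylAlgebra K →ₐ[K] WeylAlgebra K,
    ∃ γ δ : WeylAlgebra K →ₗ[K] WeylAlgebra K,
      IsInvolution γ ∧ IsInvolution δ ∧ IsInvolutiveEndomorphism γ δ f

end WeylAlgebra

/-! Conjugation reduces (1) to an endomorphism commuting with `alpha`: the anti-automorphism case is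
absorbed by composing with `alpha`. In the coordinates `u = X + Y`, `v = (Y - X) / 2` the exchange
involution becomes `flip`, fixing `u` and negating `v`. Put P = f(u) and Q = f(v). Then [Q, P] = 1
and Q is skew, and everything rests on showing that Q = c v (`eq_smul_v`). Given this, [Q, P] = 1
forces P = c⁻¹ u + b(v), so f is triangular with an explicit inverse.

To see that Q is affine in v, P and Q are spread out over a finitely generated subring of K and sent
through ℤ_[p] to ℤ/p², with p large compared with their degrees. Modulo p, the powers P^p and Q^p
are central (`mem_center_of_commute`), hence are polynomials U and V in x = u^p and y = v^p. Modulo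
p², [Q^p, P^p] = p!, while commutators of lifts of central elements are p! times Poisson brackets.
Dividing by p! gives V_y U_x - V_x U_y = 1 (`exists_jacobian_pair`).

Since p is odd, skewness of Q gives V(x, 0) = 0. A Newton polygon argument
(`eq_of_jacobian_of_coeff_zero`) then shows that a Jacobian pair with y dividing V has V a multiple
of y; the bound d² < p keeps the relevant exponent determinants nonzero in the residue field.
Leading coefficients transfer this from Q^p back to Q modulo p. A nonzero coefficient of Q is made a
unit before reduction, so the conclusion lifts to K.

In (2), (b) implies (a) by (1). Conversely, if f is bijective, `alpha` can be transported along f.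
-/

open Polynomial

/-! ### Commutation formulas for powers -/

section Commutator

variable {A : Type*} [Ring A] {a b : A}

theorem mul_pow_of_commutator_one (h : b * a = a * b + 1) (n : ℕ) :
    b * a ^ n = a ^ n * b + n • a ^ (n - 1) := by
  induction n with
  | zero => simp
  | succ n ih =>
    rw [pow_succ, ← mul_assoc, ih, add_mul, mul_assoc, h]
    rcases n with _ | n
    · simp
    · rw [Nat.add_sub_cancel, Nat.add_sub_cancel, smul_mul_assoc, ← pow_succ, mul_add, mul_one,
        ← mul_assoc, ← pow_succ, add_assoc, succ_nsmul _ (n + 1), add_comm ((n + 1) • _)]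

/-- Leibniz rule for b acting as a + d/da: moving one more b to the right adds two neighbouring
terms, which combine by Pascal's rule. -/
theorem pow_mul_pow_of_commutator_one (h : b * a = a * b + 1) (m n : ℕ) :
    b ^ m * a ^ n = ∑ k ∈ Finset.range (m + 1),
      (m.choose k * n.descFactorial k) • (a ^ (n - k) * b ^ (m - k)) := by
  induction m generalizing n with
  | zero => simp
  | succ m ih =>
    have hstep : b ^ (m + 1) * a ^ n = b ^ m * a ^ n * b + n • (b ^ m * a ^ (n - 1)) := by
      rw [pow_succ, mul_assoc, mul_pow_of_commutator_one h, mul_add, ← mul_assoc, mul_smul_comm]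
    have h1 : b ^ m * a ^ n * b = ∑ k ∈ Finset.range (m + 2),
        (m.choose k * n.descFactorial k) • (a ^ (n - k) * b ^ (m + 1 - k)) := by
      rw [Finset.sum_range_succ, Nat.choose_succ_self, zero_mul, zero_smul, add_zero, ih,
        Finset.sum_mul]
      refine Finset.sum_congr rfl fun k hk => ?_
      rw [Finset.mem_range] at hk
      rw [smul_mul_assoc, mul_assoc, ← pow_succ, Nat.succ_sub (by omega)]
    have h2 : n • (b ^ m * a ^ (n - 1)) = ∑ k ∈ Finset.range (m + 1),
        (m.choose k * n.descFactorial (k + 1)) • (a ^ (n - (k + 1)) * b ^ (m - k)) := by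
      rw [ih, Finset.smul_sum]
      refine Finset.sum_congr rfl fun k _ => ?_
      have e : n.descFactorial (k + 1) = n * (n - 1).descFactorial k := by
        rcases n with _ | n
        · simp
        · rw [Nat.succ_descFactorial_succ, Nat.add_sub_cancel]
      rw [smul_smul, e, Nat.sub_sub, add_comm 1 k]
      congr 1; ring
    rw [hstep, h1, h2, Finset.sum_range_succ', Finset.sum_range_succ' _ (m + 1), add_right_comm,
      ← Finset.sum_add_distrib]
    congr 1
    · refine Finset.sum_congr rfl fun k _ => ?_
      rw [Nat.add_sub_add_right, ← add_smul, Nat.choose_succ_succ, add_mul, add_comm]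
    · simp

/-- For 0 < k < p the coefficient in the reordering formula is k! times the square of a binomial
coefficient divisible by p, so it vanishes with p². Only k = 0 and k = p survive. -/
theorem pow_prime_commutator (h : b * a = a * b + 1) {p : ℕ} (hp : p.Prime)
    (hp2 : (p : A) ^ 2 = 0) : b ^ p * a ^ p = a ^ p * b ^ p + (p.factorial : A) := by
  rw [pow_mul_pow_of_commutator_one h, Finset.sum_range_succ, Finset.sum_eq_single 0]
  · simp [Nat.descFactorial_self]
  · intro k hk hk0
    rw [Finset.mem_range] at hk
    obtain ⟨r, hr⟩ := hp.dvd_choose_self hk0 hk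
    obtain ⟨s, hs⟩ : p ∣ p.descFactorial k := by
      rw [Nat.descFactorial_eq_factorial_mul_choose]
      exact dvd_mul_of_dvd_right (hp.dvd_choose_self hk0 hk) _
    rw [hr, hs, nsmul_eq_mul]
    have : ((p * r * (p * s) : ℕ) : A) = (p : A) ^ 2 * ((r * s : ℕ) : A) := by
      rw [← Nat.cast_pow, ← Nat.cast_mul]; congr 1; ring
    rw [this, hp2, zero_mul, zero_mul]
  · intro h0
    exact absurd hp.pos (by simpa using h0)

/-- Bracketing with b differentiates the sum with respect to a, because the coefficients commute
with b. This lowers the degree, and the integers produced can be cancelled below p. -/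
theorem eq_zero_of_sum_pow_mul_eq_zero (h : b * a = a * b + 1) {p : ℕ}
    (hinj : ∀ i, 0 < i → i < p → ∀ m : A, i • m = 0 → m = 0) (n : ℕ) (hn : n ≤ p) (m : ℕ → A)
    (hm : ∀ i, b * m i = m i * b) (hs : ∑ i ∈ Finset.range n, a ^ i * m i = 0) :
    ∀ i < n, m i = 0 := by
  induction n generalizing m with
  | zero => simp
  | succ n ih =>
    have key : ∑ i ∈ Finset.range n, a ^ i * ((i + 1) • m (i + 1)) = 0 := by
      have : ∑ i ∈ Finset.range (n + 1), i • (a ^ (i - 1) * m i) = 0 := by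
        calc _ = b * (∑ i ∈ Finset.range (n + 1), a ^ i * m i) -
              (∑ i ∈ Finset.range (n + 1), a ^ i * m i) * b := by
              rw [Finset.mul_sum, Finset.sum_mul, ← Finset.sum_sub_distrib]
              refine Finset.sum_congr rfl fun i _ => ?_
              rw [← mul_assoc, mul_pow_of_commutator_one h, mul_assoc, ← hm i, add_mul,
                smul_mul_assoc, mul_assoc]
              abel
          _ = 0 := by rw [hs, mul_zero, zero_mul, sub_zero]
      rw [Finset.sum_range_succ', zero_smul, add_zero] at this
      rw [← this]
      refine Finset.sum_congr rfl fun i _ => ?_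
      rw [Nat.add_sub_cancel, mul_smul_comm]
    have h1 := ih (by omega) (fun i => (i + 1) • m (i + 1))
      (fun i => by rw [mul_smul_comm, hm, smul_mul_assoc]) key
    have h2 : ∀ i < n, m (i + 1) = 0 := fun i hi =>
      hinj (i + 1) (by omega) (by omega) _ (h1 i hi)
    have h3 : m 0 = 0 := by
      rw [Finset.sum_range_succ', Finset.sum_eq_zero, zero_add, pow_zero, one_mul] at hs
      · exact hs
      · intro i hi
        rw [h2 i (Finset.mem_range.1 hi), mul_zero]
    intro i hi
    rcases i with _ | i
    · exact h3
    · exact h2 i (by omega)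

/-- The commutator is a central integer of square zero, so only the first-order term of the
reordering survives. -/
theorem pow_mul_pow_of_commutator_sq_zero {c : ℕ} (hc : (c : A) ^ 2 = 0) (h : b * a = a * b + c)
    (m n : ℕ) : b ^ m * a ^ n = a ^ n * b ^ m + (m * n * c) • (a ^ (n - 1) * b ^ (m - 1)) := by
  have h0 : ∀ x : A, c • c • x = 0 := fun x => by
    rw [nsmul_eq_mul, nsmul_eq_mul, ← mul_assoc, ← sq, hc, zero_mul]
  have h1 : ∀ n, b * a ^ n = a ^ n * b + (n * c) • a ^ (n - 1) := by
    intro n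
    induction n with
    | zero => simp
    | succ n ih =>
      rw [pow_succ, ← mul_assoc, ih, add_mul, mul_assoc, h]
      rcases n with _ | n
      · simp
      · rw [Nat.add_sub_cancel, Nat.add_sub_cancel, smul_mul_assoc, ← pow_succ, mul_add,
          ← mul_assoc, ← pow_succ, add_assoc, ← Nat.cast_comm, ← nsmul_eq_mul, ← add_smul]
        congr 2; ring
  induction m with
  | zero => simp
  | succ m ih =>
    have h2 : b * (m * n * c) • (a ^ (n - 1) * b ^ (m - 1)) =
        (m * n * c) • (a ^ (n - 1) * b ^ m) := by
      rcases m with _ | m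
      · simp
      · rw [mul_smul_comm, ← mul_assoc, h1, add_mul (a ^ (n - 1) * b), smul_add, Nat.add_sub_cancel,
          mul_assoc (a ^ (n - 1)), ← pow_succ', smul_mul_assoc, mul_comm (n - 1) c, mul_smul c (n - 1),
          mul_smul _ c (c • _), h0, smul_zero, add_zero]
    rw [pow_succ', mul_assoc, ih, mul_add, h2, ← mul_assoc, h1, add_mul, mul_assoc, ← pow_succ',
      smul_mul_assoc, add_assoc, ← add_smul, Nat.add_sub_cancel]
    congr 2; ring

end Commutator

/-! ### The Weyl algebra over a commutative ring and its normally ordered basis -/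

/-- The defining relation `v u = u v + 1` of the Weyl algebra over a commutative ring. -/
inductive WeylRing.Rel (R : Type*) [CommRing R] :
    FreeAlgebra R (Fin 2) → FreeAlgebra R (Fin 2) → Prop
  | comm : WeylRing.Rel R (FreeAlgebra.ι R 1 * FreeAlgebra.ι R 0)
      (FreeAlgebra.ι R 0 * FreeAlgebra.ι R 1 + 1)

/-- The first Weyl algebra over a commutative ring `R`. -/
def WeylRing (R : Type*) [CommRing R] : Type _ := RingQuot (WeylRing.Rel R)

namespace WeylRing

noncomputable instance (R : Type*) [CommRing R] : Ring (WeylRing R) :=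
  inferInstanceAs (Ring (RingQuot (Rel R)))

noncomputable instance (S R : Type*) [CommRing R] [CommRing S] [Algebra S R] :
    Algebra S (WeylRing R) :=
  inferInstanceAs (Algebra S (RingQuot (Rel R)))

instance (S R : Type*) [CommRing R] [CommRing S] [Algebra S R] :
    IsScalarTower S R (WeylRing R) :=
  inferInstanceAs (IsScalarTower S R (RingQuot (Rel R)))

/-- The quotient map from the free algebra. -/
noncomputable def mk (R : Type*) [CommRing R] : FreeAlgebra R (Fin 2) →ₐ[R] WeylRing R :=
  RingQuot.mkAlgHom R (Rel R)

section Basic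

variable (R : Type*) [CommRing R]

/-- The first generator. -/
noncomputable def u : WeylRing R := mk R (FreeAlgebra.ι R 0)

/-- The second generator. -/
noncomputable def v : WeylRing R := mk R (FreeAlgebra.ι R 1)

theorem v_mul_u : v R * u R = u R * v R + 1 := by
  have h : mk R _ = mk R _ := RingQuot.mkAlgHom_rel R (Rel.comm (R := R))
  simpa only [u, v, map_add, map_mul, map_one] using h

variable {R}
variable {A : Type*} [Ring A] [Algebra R A]

/-- The universal property of the Weyl algebra. -/
noncomputable def lift (a b : A) (h : b * a = a * b + 1) : WeylRing R →ₐ[R] A :=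
  (RingQuot.liftAlgHom R ⟨FreeAlgebra.lift R ![a, b], by rintro _ _ ⟨⟩; simpa using h⟩ :
    RingQuot (Rel R) →ₐ[R] A)

theorem lift_mk (a b : A) (h : b * a = a * b + 1) (x : FreeAlgebra R (Fin 2)) :
    lift (R := R) a b h (mk R x) = FreeAlgebra.lift R ![a, b] x :=
  RingQuot.liftAlgHom_mkAlgHom_apply R _ _ _

@[simp] theorem lift_u (a b : A) (h : b * a = a * b + 1) : lift (R := R) a b h (u R) = a := by
  simp [lift_mk, u]

@[simp] theorem lift_v (a b : A) (h : b * a = a * b + 1) : lift (R := R) a b h (v R) = b := by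
  simp [lift_mk, v]

theorem algHom_ext {f g : WeylRing R →ₐ[R] A} (hu : f (u R) = g (u R)) (hv : f (v R) = g (v R)) :
    f = g := by
  refine RingQuot.ringQuot_ext' R f g ?_
  apply FreeAlgebra.hom_ext
  funext i
  fin_cases i
  · exact hu
  · exact hv

/-- Induction on left multiplication by the generators. -/
theorem induction_left {p : WeylRing R → Prop} (one : p 1) (add : ∀ a b, p a → p b → p (a + b))
    (smul : ∀ (r : R) a, p a → p (r • a)) (u_mul : ∀ a, p a → p (u R * a))
    (v_mul : ∀ a, p a → p (v R * a)) (a : WeylRing R) : p a := by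
  suffices h : ∀ b : FreeAlgebra R (Fin 2), ∀ a, p a → p (mk R b * a) by
    obtain ⟨b, rfl⟩ := (RingQuot.mkAlgHom_surjective R (Rel R) a : ∃ b, mk R b = a)
    have := h b 1 one
    rwa [mul_one] at this
  intro b
  induction b using FreeAlgebra.induction with
  | grade0 r => intro a ha; simpa [Algebra.smul_def] using smul r a ha
  | grade1 i =>
    intro a ha
    fin_cases i
    · exact u_mul a ha
    · exact v_mul a ha
  | mul x y hx hy => intro a ha; rw [map_mul, mul_assoc]; exact hx _ (hy _ ha)
  | add x y hx hy => intro a ha; rw [map_add, add_mul]; exact add _ _ (hx _ ha) (hy _ ha)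

/-- Left multiplication on normally ordered polynomials; the outer variable corresponds to `u`
and the inner variable to `v`. -/
noncomputable def rep : WeylRing R →ₐ[R] Module.End R[X] R[X][X] :=
  lift (LinearMap.mulLeft R[X] (X : R[X][X]))
    ((X : R[X]) • (LinearMap.id : Module.End R[X] R[X][X]) + derivative) (by
      refine LinearMap.ext fun q => ?_
      simp only [Module.End.mul_apply, LinearMap.add_apply, LinearMap.smul_apply,
        LinearMap.id_apply, LinearMap.mulLeft_apply, smul_eq_C_mul, derivative_mul, derivative_X,
        Module.End.one_apply]
      ring)

theorem rep_u_mul (a : WeylRing R) (q : R[X][X]) : rep (u R * a) q = X * rep a q := by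
  simp [rep]

theorem rep_v_mul (a : WeylRing R) (q : R[X][X]) :
    rep (v R * a) q = C X * rep a q + derivative (rep a q) := by
  simp [rep, smul_eq_C_mul]

/-- The normally ordered form of an element of the Weyl algebra. -/
noncomputable def nf : WeylRing R →ₗ[R] R[X][X] where
  toFun a := rep a 1
  map_add' a b := by simp
  map_smul' r a := by simp

@[simp] theorem nf_one : nf (1 : WeylRing R) = 1 := by simp [nf]

theorem nf_mul (a b : WeylRing R) : nf (a * b) = rep a (nf b) := by simp [nf]

theorem nf_u_mul (a : WeylRing R) : nf (u R * a) = X * nf a := rep_u_mul a 1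

theorem nf_v_mul (a : WeylRing R) : nf (v R * a) = C X * nf a + derivative (nf a) := rep_v_mul a 1

theorem nf_mul_v (a : WeylRing R) : nf (a * v R) = C X * nf a := by
  have : nf (v R) = (X : R[X]) • (1 : R[X][X]) := by
    have := nf_v_mul (1 : WeylRing R)
    simpa [smul_eq_C_mul] using this
  rw [nf_mul, this, map_smul, smul_eq_C_mul]; rfl

theorem nf_u_pow_mul (n : ℕ) (a : WeylRing R) : nf (u R ^ n * a) = X ^ n * nf a := by
  induction n with
  | zero => simp
  | succ n ih => rw [pow_succ', mul_assoc, nf_u_mul, ih, pow_succ', mul_assoc]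

theorem nf_mul_v_pow (n : ℕ) (a : WeylRing R) : nf (a * v R ^ n) = C (X ^ n) * nf a := by
  induction n with
  | zero => simp
  | succ n ih => rw [pow_succ, ← mul_assoc, nf_mul_v, ih, pow_succ, C_mul]; ring

theorem nf_mul_aeval_v (a : WeylRing R) (c : R[X]) : nf (a * aeval (v R) c) = C c * nf a := by
  induction c using Polynomial.induction_on' with
  | add p q hp hq => rw [map_add, mul_add, map_add, hp, hq, C_add, add_mul]
  | monomial n r =>
    rw [aeval_monomial, ← Algebra.smul_def, mul_smul_comm, map_smul, nf_mul_v_pow,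
      ← smul_X_eq_monomial, ← smul_mul_assoc, smul_C]

variable (R) in
/-- The element of the Weyl algebra with a given normally ordered form. -/
noncomputable def ofPoly : R[X][X] →ₗ[R] WeylRing R :=
  Polynomial.lsum fun i => LinearMap.mulLeft R (u R ^ i) ∘ₗ (aeval (v R)).toLinearMap

theorem ofPoly_monomial (i : ℕ) (c : R[X]) :
    ofPoly R (monomial i c) = u R ^ i * aeval (v R) c := by
  simp [ofPoly, lsum, sum_monomial_index]

@[simp] theorem ofPoly_one : ofPoly R 1 = 1 := by
  have := ofPoly_monomial (R := R) 0 1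
  simpa using this

@[simp] theorem nf_ofPoly (q : R[X][X]) : nf (ofPoly R q) = q := by
  induction q using Polynomial.induction_on' with
  | add p q hp hq => rw [map_add, map_add, hp, hq]
  | monomial n r =>
    rw [ofPoly_monomial, nf_mul_aeval_v]
    have := nf_u_pow_mul n (1 : WeylRing R)
    rw [mul_one, nf_one, mul_one] at this
    rw [this, C_mul_X_pow_eq_monomial]

theorem aeval_v_mul_u (c : R[X]) :
    aeval (v R) c * u R = u R * aeval (v R) c + aeval (v R) (derivative c) := by
  induction c using Polynomial.induction_on with
  | C r => simp [Algebra.commutes]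
  | add p q hp hq => simp only [map_add, add_mul, mul_add, hp, hq]; abel
  | monomial n r ih =>
    have e : (C r * X ^ (n + 1) : R[X]) = C r * X ^ n * X := by ring
    generalize (C r * X ^ n : R[X]) = q at *
    rw [e, map_mul, aeval_X, mul_assoc, v_mul_u, derivative_mul, map_add, map_mul,
      aeval_X, derivative_X, mul_one, mul_add, mul_one, ← mul_assoc, ih]
    noncomm_ring

theorem ofPoly_X_mul (q : R[X][X]) : ofPoly R (X * q) = u R * ofPoly R q := by
  induction q using Polynomial.induction_on' with
  | add p q hp hq => rw [mul_add, map_add, hp, hq, map_add, mul_add]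
  | monomial n r => rw [X_mul_monomial, ofPoly_monomial, ofPoly_monomial, pow_succ', mul_assoc]

theorem ofPoly_v_mul (q : R[X][X]) : ofPoly R (C X * q + derivative q) = v R * ofPoly R q := by
  induction q using Polynomial.induction_on' with
  | add p q hp hq => 
    rw [map_add (ofPoly R) p q, mul_add (v R), ← hp, ← hq, ← map_add, map_add derivative]
    congr 1; ring
  | monomial n r =>
    rw [C_mul_monomial, derivative_monomial, map_add, ofPoly_monomial, ofPoly_monomial,
      ofPoly_monomial, ← mul_assoc, mul_pow_of_commutator_one (v_mul_u R), add_mul]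
    rw [mul_comm r, ← nsmul_eq_mul, map_nsmul, mul_smul_comm, smul_mul_assoc, map_mul, aeval_X,
      mul_assoc]

-- With `nf_ofPoly` this is the Poincaré–Birkhoff–Witt statement: the ordered monomials form an
-- R-basis, over any commutative R.
@[simp] theorem ofPoly_nf (a : WeylRing R) : ofPoly R (nf a) = a := by
  induction a using induction_left with
  | one => simp
  | add a b ha hb => rw [map_add, map_add, ha, hb]
  | smul r a ha => rw [map_smul, map_smul, ha]
  | u_mul a ha => rw [nf_u_mul, ofPoly_X_mul, ha]
  | v_mul a ha => rw [nf_v_mul, ofPoly_v_mul, ha]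

theorem nf_injective : Function.Injective (nf (R := R)) := fun a b h => by
  rw [← ofPoly_nf a, h, ofPoly_nf]

/-- Induction on normally ordered forms. -/
theorem induction_poly {p : WeylRing R → Prop} (add : ∀ a b, p a → p b → p (a + b))
    (mono : ∀ (i : ℕ) (c : R[X]), p (u R ^ i * aeval (v R) c)) (a : WeylRing R) : p a := by
  rw [← ofPoly_nf a]
  induction nf a using Polynomial.induction_on' with
  | add f g hf hg => rw [map_add]; exact add _ _ hf hg
  | monomial i c => rw [ofPoly_monomial]; exact mono i c

theorem nf_monomial (i : ℕ) (c : R[X]) : nf (u R ^ i * aeval (v R) c) = monomial i c := by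
  rw [← ofPoly_monomial, nf_ofPoly]

/-- Brackets with v and with u act on normal forms as the two partial derivatives. This determines
the centre in characteristic p, and P from Q in characteristic zero. -/
theorem nf_v_commutator (a : WeylRing R) : nf (v R * a - a * v R) = derivative (nf a) := by
  rw [map_sub, nf_v_mul, nf_mul_v, add_sub_cancel_left]

theorem nf_commutator_u (a : WeylRing R) (i : ℕ) :
    (nf (a * u R - u R * a)).coeff i = derivative ((nf a).coeff i) := by
  induction a using induction_poly with
  | add a b ha hb =>
    rw [map_add, coeff_add, map_add, ← ha, ← hb, ← coeff_add, ← map_add]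
    congr 2; noncomm_ring
  | mono j c =>
    rw [mul_assoc, aeval_v_mul_u, mul_add, ← mul_assoc, ← mul_assoc, ← pow_succ, ← pow_succ',
      add_sub_cancel_left, nf_monomial, nf_monomial, coeff_monomial, coeff_monomial]
    split <;> simp

/-- The anti-automorphism `u ↦ u`, `v ↦ -v`. -/
noncomputable def flip : WeylRing R →ₐ[R] (WeylRing R)ᵐᵒᵖ :=
  lift (MulOpposite.op (u R)) (MulOpposite.op (-v R)) (by
    rw [← MulOpposite.op_mul, ← MulOpposite.op_mul, ← MulOpposite.op_one, ← MulOpposite.op_add]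
    congr 1
    have h : -v R * u R = -(v R * u R) := neg_mul _ _
    have h' : u R * -v R = -(u R * v R) := mul_neg _ _
    rw [h, h', v_mul_u, neg_add, neg_add_cancel_right])

end Basic

/-! ### Base change -/

section Map

variable {R S : Type*} [CommRing R] [CommRing S] [Algebra R S]

variable (R S) in
/-- Base change of Weyl algebras. -/
noncomputable def map : WeylRing R →ₐ[R] WeylRing S := lift (u S) (v S) (v_mul_u S)

@[simp] theorem map_u : map R S (u R) = u S := by simp [map]

@[simp] theorem map_v : map R S (v R) = v S := by simp [map]

theorem nf_map (a : WeylRing R) :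
    nf (map R S a) = (nf a).map (mapRingHom (algebraMap R S)) := by
  induction a using induction_left with
  | one => simp
  | add a b ha hb => simp [ha, hb]
  | smul r a ha =>
    rw [map_smul (map R S), map_smul (nf (R := R)), ← algebraMap_smul S r,
      map_smul (nf (R := S)), ha]
    ext i j; simp
  | u_mul a ha => rw [map_mul, map_u, nf_u_mul, ha, nf_u_mul]; simp
  | v_mul a ha => rw [map_mul, map_v, nf_v_mul, ha, nf_v_mul]; simp [derivative_map]

theorem coeff_nf_map (a : WeylRing R) (i j : ℕ) :
    ((nf (map R S a)).coeff i).coeff j = algebraMap R S (((nf a).coeff i).coeff j) := by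
  simp [nf_map]

theorem flip_map (a : WeylRing R) :
    (flip (map R S a)).unop = map R S (flip a).unop := by
  induction a using induction_left with
  | one => simp
  | add a b ha hb => simp [ha, hb]
  | smul r a ha =>
    rw [map_smul (map R S), map_smul (flip (R := R)), ← algebraMap_smul S r,
      map_smul (flip (R := S)), MulOpposite.unop_smul, ha, MulOpposite.unop_smul,
      map_smul (map R S), algebraMap_smul]
  | u_mul a ha => simp [ha]; simp [flip]
  | v_mul a ha => simp [ha]; simp [flip]

end Map

/-! ### Degrees in u and in v -/

section Degree

variable {R : Type*} [CommRing R]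

theorem nf_aeval_v_mul (c : R[X]) (b : WeylRing R) {n : ℕ} (hb : (nf b).natDegree ≤ n) :
    (nf (aeval (v R) c * b)).natDegree ≤ n ∧
      (nf (aeval (v R) c * b)).coeff n = c * (nf b).coeff n := by
  induction c using Polynomial.induction_on with
  | C r =>
    rw [aeval_C, ← Algebra.smul_def, map_smul, ← algebraMap_smul R[X] r, smul_eq_C_mul]
    exact ⟨(natDegree_C_mul_le _ _).trans hb, by rw [coeff_C_mul]; rfl⟩
  | add p q hp hq =>
    rw [map_add, add_mul, map_add]
    exact ⟨(natDegree_add_le _ _).trans (max_le hp.1 hq.1), by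
      rw [coeff_add, hp.2, hq.2, add_mul]⟩
  | monomial k r ih =>
    have e : aeval (v R) (C r * X ^ (k + 1)) * b = v R * (aeval (v R) (C r * X ^ k) * b) := by
      rw [pow_succ', mul_left_comm, map_mul, aeval_X, mul_assoc]
    rw [e, nf_v_mul]
    refine ⟨(natDegree_add_le _ _).trans (max_le ((natDegree_C_mul_le _ _).trans ih.1)
      ((natDegree_derivative_le _).trans (by omega))), ?_⟩
    rw [coeff_add, coeff_derivative, coeff_eq_zero_of_natDegree_lt (by omega : _ < n + 1),
      coeff_C_mul, ih.2]
    ring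

/-- Moving v past u only creates terms of lower degree in u, so the top coefficients in u multiply
as in a commutative polynomial ring. -/
theorem nf_mul_top (a b : WeylRing R) {m n : ℕ} (ha : (nf a).natDegree ≤ m)
    (hb : (nf b).natDegree ≤ n) :
    (nf (a * b)).natDegree ≤ m + n ∧
      (nf (a * b)).coeff (m + n) = (nf a).coeff m * (nf b).coeff n := by
  obtain ⟨q, rfl⟩ : ∃ q, a = ofPoly R q := ⟨nf a, (ofPoly_nf a).symm⟩
  rw [nf_ofPoly] at ha ⊢
  refine Polynomial.induction_with_natDegree_le
    (fun q => (nf (ofPoly R q * b)).natDegree ≤ m + n ∧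
      (nf (ofPoly R q * b)).coeff (m + n) = q.coeff m * (nf b).coeff n) m ?_ ?_ ?_ q ha
  · simp
  · intro i r _ hi
    obtain ⟨h1, h2⟩ := nf_aeval_v_mul r b hb
    rw [C_mul_X_pow_eq_monomial, ofPoly_monomial, mul_assoc, nf_u_pow_mul]
    refine ⟨(natDegree_mul_le).trans (add_le_add ((natDegree_X_pow_le i).trans hi) h1), ?_⟩
    rw [coeff_X_pow_mul', coeff_monomial, if_pos (by omega)]
    split_ifs with h
    · rw [h, Nat.add_sub_cancel_left, h2]
    · rw [zero_mul]
      exact coeff_eq_zero_of_natDegree_lt (by omega)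
  · intro f g _ _ hf hg
    obtain ⟨f1, f2⟩ := hf
    obtain ⟨g1, g2⟩ := hg
    rw [map_add, add_mul, map_add]
    exact ⟨(natDegree_add_le _ _).trans (max_le f1 g1), by
      rw [coeff_add, f2, g2, coeff_add, add_mul]⟩

instance [IsDomain R] : NoZeroDivisors (WeylRing R) where
  eq_zero_or_eq_zero_of_mul_eq_zero {a b} h := by
    by_contra! hab
    have h1 := (nf_mul_top a b le_rfl le_rfl).2
    rw [h, map_zero, coeff_zero] at h1
    rcases mul_eq_zero.1 h1.symm with h2 | h2
    · exact hab.1 (nf_injective (by simpa using h2))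
    · exact hab.2 (nf_injective (by simpa using h2))

theorem nf_pow_top (a : WeylRing R) {m : ℕ} (ha : (nf a).natDegree ≤ m) (k : ℕ) :
    (nf (a ^ k)).natDegree ≤ k * m ∧ (nf (a ^ k)).coeff (k * m) = (nf a).coeff m ^ k := by
  induction k with
  | zero => simp
  | succ k ih =>
    rw [pow_succ, Nat.succ_mul, pow_succ, ← ih.2]
    exact nf_mul_top _ _ ih.1 ha

theorem nf_eq_sum (a : WeylRing R) :
    a = ∑ i ∈ (nf a).support, u R ^ i * aeval (v R) ((nf a).coeff i) := by
  conv_lhs => rw [← ofPoly_nf a, (nf a).as_sum_support, map_sum]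
  exact Finset.sum_congr rfl fun i _ => ofPoly_monomial i _

/-- The normally ordered form of `a` has degree at most `d` in `v`. -/
def VDegreeLE (d : ℕ) (a : WeylRing R) : Prop := ∀ i, ((nf a).coeff i).natDegree ≤ d

theorem VDegreeLE.mono {d e : ℕ} (h : d ≤ e) {a : WeylRing R} (ha : VDegreeLE d a) :
    VDegreeLE e a := fun i => (ha i).trans h

theorem VDegreeLE.add {d : ℕ} {a b : WeylRing R} (ha : VDegreeLE d a) (hb : VDegreeLE d b) :
    VDegreeLE d (a + b) := fun i => by
  rw [map_add, coeff_add]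
  exact (natDegree_add_le _ _).trans (max_le (ha i) (hb i))

theorem VDegreeLE.sum {d : ℕ} {ι : Type*} (s : Finset ι) {f : ι → WeylRing R}
    (h : ∀ i ∈ s, VDegreeLE d (f i)) : VDegreeLE d (∑ i ∈ s, f i) := by
  induction s using Finset.cons_induction with
  | empty => intro i; simp
  | cons i s hi ih =>
    rw [Finset.sum_cons]
    exact (h _ (by simp)).add (ih fun j hj => h _ (by simp [hj]))

theorem VDegreeLE.aeval_v_mul {m n : ℕ} {c : R[X]} (hc : c.natDegree ≤ m) {b : WeylRing R}
    (hb : VDegreeLE n b) : VDegreeLE (m + n) (aeval (v R) c * b) := by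
  refine Polynomial.induction_with_natDegree_le
    (fun c => VDegreeLE (m + n) (aeval (v R) c * b)) m ?_ ?_ ?_ c hc
  · intro i; simp
  · intro k r _ hk
    suffices h : VDegreeLE (k + n) (aeval (v R) (C r * X ^ k) * b) from h.mono (by omega)
    clear hk
    induction k with
    | zero =>
      intro i
      rw [pow_zero, mul_one, aeval_C, ← Algebra.smul_def, map_smul, coeff_smul, zero_add]
      exact (natDegree_smul_le _ _).trans (hb i)
    | succ k ih =>
      have e : aeval (v R) (C r * X ^ (k + 1)) * b = v R * (aeval (v R) (C r * X ^ k) * b) := by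
        rw [pow_succ', mul_left_comm, map_mul, aeval_X, mul_assoc]
      intro i
      rw [e, nf_v_mul, coeff_add, coeff_C_mul, coeff_derivative]
      refine (natDegree_add_le _ _).trans (max_le (natDegree_mul_le.trans ?_)
        (natDegree_mul_le.trans ?_))
      · have := ih i
        have := natDegree_X_le (R := R)
        omega
      · have := ih (i + 1)
        have e : ((i : R[X]) + 1).natDegree = 0 := by
          rw [← Nat.cast_succ]; exact natDegree_natCast _
        omega
  · intro f g _ _ hf hg
    rw [map_add, add_mul]
    exact hf.add hg

theorem VDegreeLE.mul {m n : ℕ} {a b : WeylRing R} (ha : VDegreeLE m a) (hb : VDegreeLE n b) :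
    VDegreeLE (m + n) (a * b) := by
  rw [nf_eq_sum a, Finset.sum_mul]
  refine VDegreeLE.sum _ fun i _ j => ?_
  rw [mul_assoc, nf_u_pow_mul, coeff_X_pow_mul']
  split_ifs
  · exact VDegreeLE.aeval_v_mul (ha i) hb _
  · simp

theorem VDegreeLE.pow {m : ℕ} {a : WeylRing R} (ha : VDegreeLE m a) (k : ℕ) :
    VDegreeLE (k * m) (a ^ k) := by
  induction k with
  | zero =>
    intro i
    rw [pow_zero, nf_one, coeff_one]
    split_ifs <;> simp
  | succ k ih => rw [pow_succ, Nat.succ_mul]; exact ih.mul ha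

end Degree

/-! ### The centre in characteristic p -/

section Center

theorem commute_all_of_commute_generators {R : Type*} [CommRing R] {z : WeylRing R}
    (hu : z * u R = u R * z) (hv : z * v R = v R * z) (a : WeylRing R) : z * a = a * z := by
  induction a using induction_left with
  | one => simp
  | add a b ha hb => rw [mul_add, add_mul, ha, hb]
  | smul r a ha => rw [mul_smul_comm, smul_mul_assoc, ha]
  | u_mul a ha => rw [← mul_assoc, hu, mul_assoc, ha, mul_assoc]
  | v_mul a ha => rw [← mul_assoc, hv, mul_assoc, ha, mul_assoc]

variable {k : Type*} [Field k] {p : ℕ} [CharP k p]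

theorem natCast_char_eq_zero (k : Type*) [Field k] (p : ℕ) [CharP k p] : (p : WeylRing k) = 0 := by
  rw [← map_natCast (algebraMap k (WeylRing k)), CharP.cast_eq_zero, map_zero]

theorem u_pow_char_mem_center (k : Type*) [Field k] (p : ℕ) [CharP k p] :
    u k ^ p ∈ Subalgebra.center k (WeylRing k) := by
  rw [Subalgebra.mem_center_iff]
  intro b
  refine (commute_all_of_commute_generators ?_ ?_ b).symm
  · rw [← pow_succ, ← pow_succ']
  · rw [mul_pow_of_commutator_one (v_mul_u k), nsmul_eq_mul, natCast_char_eq_zero, zero_mul,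
      add_zero]

theorem v_pow_char_mem_center (k : Type*) [Field k] (p : ℕ) [CharP k p] :
    v k ^ p ∈ Subalgebra.center k (WeylRing k) := by
  rw [Subalgebra.mem_center_iff]
  intro b
  refine (commute_all_of_commute_generators ?_ ?_ b).symm
  · have := aeval_v_mul_u (X ^ p : k[X])
    rwa [derivative_X_pow, CharP.cast_eq_zero, C_0, zero_mul, map_zero, add_zero, map_pow,
      aeval_X] at this
  · rw [← pow_succ, ← pow_succ']

-- Dividing both exponents by p moves the quotients into the central powers of `u ^ p` and `v ^ p`,
-- leaving at most p² remainder monomials.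
open Classical in
theorem span_center_eq_top (hp : p.Prime) :
    Submodule.span (Subalgebra.center k (WeylRing k))
      ((Finset.univ.image fun ij : Fin p × Fin p => u k ^ (ij.1 : ℕ) * v k ^ (ij.2 : ℕ) :
        Finset (WeylRing k)) : Set (WeylRing k)) = ⊤ := by
  rw [eq_top_iff]
  intro a _
  rw [nf_eq_sum a]
  refine Submodule.sum_mem _ fun i _ => ?_
  rw [aeval_eq_sum_range, Finset.mul_sum]
  refine Submodule.sum_mem _ fun j _ => ?_
  have hmem : u k ^ (i % p) * v k ^ (j % p) ∈ Submodule.span (Subalgebra.center k (WeylRing k))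
      ((Finset.univ.image fun ij : Fin p × Fin p => u k ^ (ij.1 : ℕ) * v k ^ (ij.2 : ℕ) :
        Finset (WeylRing k)) : Set (WeylRing k)) := by
    refine Submodule.subset_span ?_
    rw [Finset.coe_image]
    exact ⟨(⟨i % p, Nat.mod_lt _ hp.pos⟩, ⟨j % p, Nat.mod_lt _ hp.pos⟩), by simp, rfl⟩
  let U : Subalgebra.center k (WeylRing k) := ⟨_, u_pow_char_mem_center k p⟩
  let V : Subalgebra.center k (WeylRing k) := ⟨_, v_pow_char_mem_center k p⟩
  have e : u k ^ i * ((nf a).coeff i).coeff j • v k ^ j =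
      ((nf a).coeff i).coeff j • (U ^ (i / p) * V ^ (j / p)) • (u k ^ (i % p) * v k ^ (j % p)) := by
    rw [mul_smul_comm]
    congr 1
    change _ = ((U ^ (i / p) * V ^ (j / p) : Subalgebra.center k (WeylRing k)) : WeylRing k) *
      (u k ^ (i % p) * v k ^ (j % p))
    have hV := (Subalgebra.mem_center_iff.1 (V ^ (j / p)).2 (u k ^ (i % p)))
    push_cast at hV ⊢
    rw [mul_assoc, ← mul_assoc _ (u k ^ (i % p)), ← hV, mul_assoc, ← mul_assoc]
    change _ = (u k ^ p) ^ (i / p) * u k ^ (i % p) * ((v k ^ p) ^ (j / p) * v k ^ (j % p))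
    rw [← pow_mul, ← pow_mul, ← pow_add, ← pow_add, Nat.div_add_mod, Nat.div_add_mod]
  rw [e]
  exact Submodule.smul_of_tower_mem _ _ (Submodule.smul_mem _ _ hmem)

end Center

instance {R : Type*} [CommRing R] [Nontrivial R] : Nontrivial (WeylRing R) :=
  ⟨0, 1, fun h => zero_ne_one (by simpa using congr_arg nf h : (0 : R[X][X]) = 1)⟩

/-! ### Weyl pairs in characteristic p have central p-th powers -/

section CentralPower

variable {k : Type*} [Field k] {p : ℕ} [CharP k p]

theorem smul_eq_zero_of_lt_char {i : ℕ} (h0 : 0 < i) (hi : i < p)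
    {m : WeylRing k} (h : i • m = 0) : m = 0 := by
  rw [← Nat.cast_smul_eq_nsmul k] at h
  refine (smul_eq_zero.1 h).resolve_left fun h' => ?_
  rw [CharP.cast_eq_zero_iff k p] at h'
  exact absurd (Nat.le_of_dvd h0 h') (by omega)

/-- The derivation argument is used twice: bracketing with Q separates the powers of P, then the
Weyl pair (Q, -P) separates the powers of Q. -/
theorem eq_zero_of_sum_center_mul_eq_zero {P Q : WeylRing k}
    (h : Q * P = P * Q + 1) (c : Fin p × Fin p → Subalgebra.center k (WeylRing k))
    (hc : ∑ ij, (c ij : WeylRing k) * (P ^ (ij.1 : ℕ) * Q ^ (ij.2 : ℕ)) = 0) : c = 0 := by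
  have hcomm : ∀ ij (x : WeylRing k), (c ij : WeylRing k) * x = x * c ij := fun ij x =>
    (Subalgebra.mem_center_iff.1 (c ij).2 x).symm
  let d : ℕ → ℕ → WeylRing k := fun i j => if hij : i < p ∧ j < p then c (⟨i, hij.1⟩, ⟨j, hij.2⟩)
    else 0
  have hd : ∀ i j x, d i j * x = x * d i j := by
    intro i j x
    simp only [d]
    split_ifs
    · exact hcomm _ _
    · simp
  have hinj : ∀ i, 0 < i → i < p → ∀ m : WeylRing k, i • m = 0 → m = 0 := fun i h0 hi m hm =>
    smul_eq_zero_of_lt_char h0 hi hm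
  have h1 : ∑ i ∈ Finset.range p, P ^ i * ∑ j ∈ Finset.range p, Q ^ j * d i j = 0 := by
    rw [← hc, Fintype.sum_prod_type, Finset.sum_range]
    refine Finset.sum_congr rfl fun i _ => ?_
    rw [Finset.sum_range, Finset.mul_sum]
    refine Finset.sum_congr rfl fun j _ => ?_
    rw [hcomm, ← mul_assoc]
    simp [d]
  have h2 := eq_zero_of_sum_pow_mul_eq_zero h hinj p le_rfl
    (fun i => ∑ j ∈ Finset.range p, Q ^ j * d i j) (fun i => by
      rw [Finset.mul_sum, Finset.sum_mul]
      refine Finset.sum_congr rfl fun j _ => ?_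
      rw [mul_assoc, hd, ← mul_assoc, ← mul_assoc, ← pow_succ, ← pow_succ']) h1
  have h' : -P * Q = Q * -P + 1 := by rw [neg_mul, mul_neg, h]; abel
  funext ⟨i, j⟩
  have h3 := eq_zero_of_sum_pow_mul_eq_zero h' hinj p le_rfl (fun j => d i j)
    (fun j => (hd _ _ _).symm) (h2 i i.2) j j.2
  simpa [d] using h3

/-- In characteristic `p`, an element commuting with a Weyl pair is central. -/
theorem mem_center_of_commute (hp : p.Prime) {P Q z : WeylRing k} (h : Q * P = P * Q + 1)
    (hP : z * P = P * z) (hQ : z * Q = Q * z) : z ∈ Subalgebra.center k (WeylRing k) := by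
  classical
  rw [Subalgebra.mem_center_iff]
  intro y
  -- These p² + 1 elements are dependent over the centre, which generates the algebra with at most
  -- p² elements. As the monomials in P and Q are independent, y has a nonzero coefficient; so a
  -- nonzero central multiple of y commutes with z, and the absence of zero divisors finishes.
  let f : Option (Fin p × Fin p) → WeylRing k := fun o =>
    o.elim y fun ij => P ^ (ij.1 : ℕ) * Q ^ (ij.2 : ℕ)
  have hf : ¬ LinearIndependent (Subalgebra.center k (WeylRing k)) f := by
    intro hli
    have h1 := linearIndependent_le_span_finset f hli _ (span_center_eq_top hp)
    have h2 : Cardinal.mk (Option (Fin p × Fin p)) ≤ ((p * p : ℕ) : Cardinal) :=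
      h1.trans (by
        refine Nat.cast_le.2 (Finset.card_image_le.trans ?_)
        simp)
    rw [Cardinal.mk_fintype, Nat.cast_le] at h2
    simp at h2
  obtain ⟨g, hg, i, hi⟩ := Fintype.not_linearIndependent_iff.1 hf
  rw [Fintype.sum_option] at hg
  have hpow : ∀ i j : ℕ, z * (P ^ i * Q ^ j) = P ^ i * Q ^ j * z := fun i j =>
    ((Commute.pow_right hP i).mul_right (Commute.pow_right hQ j)).eq
  have hz : ∀ x : WeylRing k, (g none : WeylRing k) * x = x * g none := fun x =>
    (Subalgebra.mem_center_iff.1 (g none).2 x).symm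
  have hc : (g none : WeylRing k) ≠ 0 := by
    intro h0
    have h0' : g none = 0 := Subtype.ext h0
    rw [h0', zero_smul, zero_add] at hg
    have := eq_zero_of_sum_center_mul_eq_zero h (fun ij => g (some ij)) hg
    rcases i with _ | i
    · exact hi h0'
    · exact hi (congr_fun this i)
  have hy : (g none : WeylRing k) * y = -∑ ij, g (some ij) • f (some ij) := eq_neg_of_add_eq_zero_left hg
  have hzy : z * ((g none : WeylRing k) * y) = (g none : WeylRing k) * y * z := by
    rw [hy, mul_neg, neg_mul, Finset.mul_sum, Finset.sum_mul]
    congr 1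
    refine Finset.sum_congr rfl fun ij _ => ?_
    change z * ((g (some ij) : WeylRing k) * (P ^ (ij.1 : ℕ) * Q ^ (ij.2 : ℕ))) =
      (g (some ij) : WeylRing k) * (P ^ (ij.1 : ℕ) * Q ^ (ij.2 : ℕ)) * z
    rw [← mul_assoc, Subalgebra.mem_center_iff.1 (g (some ij)).2 z, mul_assoc, hpow]
    exact (mul_assoc _ _ _).symm
  have : (g none : WeylRing k) * (z * y - y * z) = 0 := by
    rw [mul_sub, ← mul_assoc, ← mul_assoc, hz z, mul_assoc, hzy, sub_self]
  exact (sub_eq_zero.1 ((mul_eq_zero.1 this).resolve_left hc)).symm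

theorem pow_char_mem_center (hp : p.Prime) {P Q : WeylRing k} (h : Q * P = P * Q + 1) :
    P ^ p ∈ Subalgebra.center k (WeylRing k) := by
  refine mem_center_of_commute hp h ?_ ?_
  · rw [← pow_succ, ← pow_succ']
  · rw [mul_pow_of_commutator_one h, nsmul_eq_mul, natCast_char_eq_zero, zero_mul, add_zero]

theorem pow_char_mem_center' (hp : p.Prime) {P Q : WeylRing k} (h : Q * P = P * Q + 1) :
    Q ^ p ∈ Subalgebra.center k (WeylRing k) := by
  refine pow_char_mem_center (Q := -P) hp ?_
  rw [neg_mul, mul_neg, h]; abel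

end CentralPower

/-! ### Central elements as polynomials in u^p and v^p -/

section Frobenius

/-- Substitution of `u ^ p` and `v ^ p` in a bivariate polynomial, in normally ordered form. -/
noncomputable def expandPoly (R : Type*) [CommRing R] (p : ℕ) : R[X][X] →+* R[X][X] :=
  (expand R[X] p).toRingHom.comp (mapRingHom (expand R p).toRingHom)

theorem expandPoly_monomial {R : Type*} [CommRing R] (p i j : ℕ) (r : R) :
    expandPoly R p (monomial i (monomial j r)) = monomial (i * p) (monomial (j * p) r) := by
  simp [expandPoly]

theorem coeff_expandPoly {R : Type*} [CommRing R] {p : ℕ} (hp : 0 < p) (f : R[X][X]) (i j : ℕ) :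
    ((expandPoly R p f).coeff (i * p)).coeff (j * p) = (f.coeff i).coeff j := by
  simp [expandPoly, coeff_expand_mul hp]

theorem map_expandPoly {R S : Type*} [CommRing R] [CommRing S] (g : R →+* S) (p : ℕ)
    (f : R[X][X]) :
    (expandPoly R p f).map (mapRingHom g) = expandPoly S p (f.map (mapRingHom g)) := by
  induction f using Polynomial.induction_on' with
  | add a b ha hb => simp [ha, hb]
  | monomial i c =>
    simp [expandPoly, map_expand]

/-- Both partial derivatives of the normal form of a central element vanish, so in characteristic p
every exponent is a multiple of p. -/
theorem exists_expandPoly_eq_of_mem_center {k : Type*} [Field k] {p : ℕ} [CharP k p]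
    (hp : p.Prime) {z : WeylRing k} (hz : z ∈ Subalgebra.center k (WeylRing k)) :
    ∃ f, nf z = expandPoly k p f := by
  rw [Subalgebra.mem_center_iff] at hz
  have h1 : derivative (nf z) = 0 := by rw [← nf_v_commutator, hz, sub_self, map_zero]
  have h2 : ∀ i, derivative ((nf z).coeff i) = 0 := fun i => by
    rw [← nf_commutator_u, hz, sub_self, map_zero, coeff_zero]
  have e1 : expand k[X] p (contract p (nf z)) = nf z := expand_contract p h1 hp.ne_zero
  obtain ⟨f, hf⟩ : contract p (nf z) ∈ lifts (expand k p).toRingHom := by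
    rw [lifts_iff_coeff_lifts]
    intro n
    rw [coeff_contract hp.ne_zero]
    exact ⟨_, expand_contract p (h2 _) hp.ne_zero⟩
  refine ⟨f, ?_⟩
  rw [← e1, ← hf]
  rfl

end Frobenius

/-! ### The Poisson bracket on the centre, obtained from commutators modulo p² -/

section Jacobian

/-- The coefficient of `x ^ N y ^ M` in `x y (∂V/∂y ∂U/∂x - ∂V/∂x ∂U/∂y)`. -/
def jacobianCoeff {R : Type*} [CommRing R] (V U : ℕ → ℕ → R) (N M : ℕ) : R :=
  ∑ x ∈ Finset.HasAntidiagonal.antidiagonal N, ∑ y ∈ Finset.HasAntidiagonal.antidiagonal M,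
    ((y.1 * x.2 : ℕ) - (x.1 * y.2 : ℕ) : R) * (V x.1 y.1 * U x.2 y.2)

/-- The coefficient function of a bivariate polynomial. -/
noncomputable def coeffs {R : Type*} [CommRing R] (f : R[X][X]) (i j : ℕ) : R := (f.coeff i).coeff j

variable {R S : Type*} [CommRing R] [CommRing S]

theorem coeffs_add (f g : R[X][X]) (i j : ℕ) : coeffs (f + g) i j = coeffs f i j + coeffs g i j := by
  simp [coeffs]

theorem coeffs_monomial (a c : ℕ) (r : R) (i j : ℕ) :
    coeffs (monomial a (monomial c r)) i j = if a = i ∧ c = j then r else 0 := by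
  rw [coeffs, coeff_monomial]
  by_cases h : a = i <;> simp [h, coeff_monomial]

theorem induction_bimonomial {motive : R[X][X] → Prop}
    (add : ∀ f g, motive f → motive g → motive (f + g))
    (mono : ∀ (a c : ℕ) (r : R), motive (monomial a (monomial c r))) (f : R[X][X]) : motive f := by
  induction f using Polynomial.induction_on' with
  | add f g hf hg => exact add f g hf hg
  | monomial a q =>
    induction q using Polynomial.induction_on' with
    | add f g hf hg => rw [map_add]; exact add _ _ hf hg
    | monomial c r => exact mono a c r

theorem jacobianCoeff_map (g : R →+* S) (V U : ℕ → ℕ → R) (N M : ℕ) :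
    jacobianCoeff (fun i j => g (V i j)) (fun i j => g (U i j)) N M =
      g (jacobianCoeff V U N M) := by
  simp [jacobianCoeff]

theorem jacobianCoeff_monomial (a c b e : ℕ) (r s : R) (N M : ℕ) :
    jacobianCoeff (coeffs (monomial a (monomial c r))) (coeffs (monomial b (monomial e s))) N M =
      if a + b = N ∧ c + e = M then ((c * b : ℕ) - (a * e : ℕ) : R) * (r * s) else 0 := by
  rw [jacobianCoeff]
  simp only [coeffs_monomial]
  split_ifs with h
  · obtain ⟨rfl, rfl⟩ := h
    rw [Finset.sum_eq_single (a, b), Finset.sum_eq_single (c, e)]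
    · simp
    · rintro ⟨y1, y2⟩ _ hne
      have : ¬ (c = y1 ∧ e = y2) := fun h => hne (by rw [h.1, h.2])
      by_cases h1 : e = y2
      · rw [if_neg fun h2 => this ⟨h2.2, h1⟩, zero_mul, mul_zero]
      · simp [h1]
    · intro h; simp at h
    · rintro ⟨x1, x2⟩ _ hne
      have : ¬ (a = x1 ∧ b = x2) := fun h => hne (by rw [h.1, h.2])
      refine Finset.sum_eq_zero fun y _ => ?_
      by_cases h1 : b = x2
      · rw [if_neg fun h2 => this ⟨h2.1, h1⟩, zero_mul, mul_zero]
      · simp [h1]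
    · intro h; simp at h
  · refine Finset.sum_eq_zero fun x hx => Finset.sum_eq_zero fun y hy => ?_
    rw [Finset.HasAntidiagonal.mem_antidiagonal] at hx hy
    by_cases h1 : a = x.1 ∧ c = y.1
    · by_cases h2 : b = x.2 ∧ e = y.2
      · exact absurd ⟨by omega, by omega⟩ h
      · rw [if_neg h2, mul_zero, mul_zero]
    · rw [if_neg h1, zero_mul, mul_zero]

theorem jacobianCoeff_add_left (V V' U : ℕ → ℕ → R) (N M : ℕ) :
    jacobianCoeff (fun i j => V i j + V' i j) U N M =
      jacobianCoeff V U N M + jacobianCoeff V' U N M := by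
  simp only [jacobianCoeff, add_mul, mul_add, Finset.sum_add_distrib]

theorem jacobianCoeff_add_right (V U U' : ℕ → ℕ → R) (N M : ℕ) :
    jacobianCoeff V (fun i j => U i j + U' i j) N M =
      jacobianCoeff V U N M + jacobianCoeff V U' N M := by
  simp only [jacobianCoeff, mul_add, Finset.sum_add_distrib]

theorem ofPoly_bimonomial (i j : ℕ) (r : R) :
    ofPoly R (monomial i (monomial j r)) = r • (u R ^ i * v R ^ j) := by
  rw [ofPoly_monomial, aeval_monomial, ← Algebra.smul_def, mul_smul_comm]

theorem ofPoly_expandPoly_bimonomial (p i j : ℕ) (r : R) :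
    ofPoly R (expandPoly R p (monomial i (monomial j r))) =
      r • ((u R ^ p) ^ i * (v R ^ p) ^ j) := by
  rw [expandPoly_monomial, ofPoly_bimonomial, ← pow_mul, ← pow_mul, mul_comm i, mul_comm j]

/-- The outer factors x and y raise the exponents by one, so that the truncated subtractions in the
reordering formula disappear and no exponent needs to be positive. -/
theorem monomial_commutator {A : Type*} [Ring A] {x y : A} {π : ℕ} (hπ : (π : A) ^ 2 = 0)
    (h : y * x = x * y + π) (a c b e : ℕ) :
    x * (x ^ a * y ^ c * (x ^ b * y ^ e) - x ^ b * y ^ e * (x ^ a * y ^ c)) * y =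
      (((c * b : ℕ) - (a * e : ℕ) : ℤ) * π) • (x ^ (a + b) * y ^ (c + e)) := by
  have key : ∀ a c b e : ℕ, x * (x ^ a * y ^ c * (x ^ b * y ^ e)) * y =
      x ^ (a + b + 1) * y ^ (c + e + 1) + (c * b * π) • (x ^ (a + b) * y ^ (c + e)) := by
    intro a c b e
    have e1 : x * (x ^ a * y ^ c * (x ^ b * y ^ e)) * y =
        x ^ (a + 1) * (y ^ c * x ^ b) * y ^ (e + 1) := by
      rw [pow_succ', pow_succ]; simp only [mul_assoc]
    rw [e1, pow_mul_pow_of_commutator_sq_zero hπ h, mul_add, add_mul]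
    congr 1
    · rw [← mul_assoc, ← pow_add, mul_assoc, ← pow_add]
      congr 2; ring
    · rw [mul_smul_comm, smul_mul_assoc]
      rcases b with _ | b
      · simp
      · rcases c with _ | c
        · simp
        · rw [Nat.add_sub_cancel, Nat.add_sub_cancel, ← mul_assoc, ← pow_add,
            mul_assoc (x ^ (a + 1 + b)), ← pow_add]
          congr 3 <;> ring
  rw [mul_sub, sub_mul, key, key, add_comm b a, add_comm e c, add_sub_add_left_eq_sub,
    ← natCast_zsmul, ← natCast_zsmul, ← sub_smul]
  congr 1
  push_cast
  ring

/-- By bilinearity it suffices to treat monomials in x = u^p and y = v^p, for which [y, x] = p! has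
square zero. -/
theorem coeffs_commutator_expandPoly {p : ℕ} (hp : p.Prime) (hp2 : (p : R) ^ 2 = 0)
    (V U : R[X][X]) (N M : ℕ) :
    coeffs (nf (u R ^ p * (ofPoly R (expandPoly R p V) * ofPoly R (expandPoly R p U) -
      ofPoly R (expandPoly R p U) * ofPoly R (expandPoly R p V)) * v R ^ p)) (N * p) (M * p) =
      (p.factorial : R) * jacobianCoeff (coeffs V) (coeffs U) N M := by
  have hp2' : ((p : ℕ) : WeylRing R) ^ 2 = 0 := by
    rw [← map_natCast (algebraMap R (WeylRing R)), ← map_pow, hp2, map_zero]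
  induction V using induction_bimonomial with
  | add V V' h h' =>
    rw [funext₂ (coeffs_add V V'), jacobianCoeff_add_left, mul_add, ← h, ← h', ← coeffs_add,
      ← map_add nf, map_add (expandPoly R p) V V', map_add (ofPoly R)]
    congr 2; noncomm_ring
  | mono a c r =>
  induction U using induction_bimonomial with
  | add U U' h h' =>
    rw [funext₂ (coeffs_add U U'), jacobianCoeff_add_right, mul_add, ← h, ← h', ← coeffs_add,
      ← map_add nf, map_add (expandPoly R p) U U', map_add (ofPoly R)]
    congr 2; noncomm_ring
  | mono b e s =>
    have hfac : ((p.factorial : ℕ) : WeylRing R) ^ 2 = 0 := by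
      obtain ⟨t, ht⟩ := Nat.dvd_factorial hp.pos le_rfl
      rw [ht, ← Nat.cast_pow, mul_pow, Nat.cast_mul, Nat.cast_pow, hp2', zero_mul]
    have hcomm := pow_prime_commutator (v_mul_u R) hp hp2'
    have hm := monomial_commutator hfac hcomm a c b e
    rw [ofPoly_expandPoly_bimonomial, ofPoly_expandPoly_bimonomial, smul_mul_smul_comm,
      smul_mul_smul_comm, mul_comm s r, ← smul_sub, mul_smul_comm, smul_mul_assoc, hm,
      ← Int.cast_smul_eq_zsmul R, smul_smul, ← ofPoly_expandPoly_bimonomial, nf_ofPoly]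
    rw [jacobianCoeff_monomial, expandPoly_monomial, coeffs_monomial]
    have e1 : ((a + b) * p = N * p ∧ (c + e) * p = M * p) ↔ (a + b = N ∧ c + e = M) := by
      rw [Nat.mul_left_inj hp.ne_zero, Nat.mul_left_inj hp.ne_zero]
    simp only [e1]
    split_ifs
    · push_cast
      ring
    · rw [mul_zero]

variable {K : Type*} [Field K] [Algebra R K] {p : ℕ}

theorem exists_eq_smul_of_map_eq_zero (hker : ∀ x : R, algebraMap R K x = 0 → ∃ y, x = p * y)
    {t : WeylRing R} (ht : map R K t = 0) : ∃ y, t = (p : R) • y := by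
  have h : C (C (p : R)) ∣ nf t := by
    rw [C_dvd_iff_dvd_coeff]
    intro i
    rw [C_dvd_iff_dvd_coeff]
    intro j
    refine (hker _ ?_)
    rw [← coeff_nf_map, ht, map_zero, coeff_zero, coeff_zero]
  obtain ⟨f, hf⟩ := h
  refine ⟨ofPoly R f, nf_injective ?_⟩
  rw [map_smul, nf_ofPoly, hf]
  ext i j
  simp

/-- The commutators of a lift of a central element are divisible by p, so multiplying them by p once
more gives zero. -/
theorem smul_commute_of_map_mem_center (hp2 : (p : R) ^ 2 = 0)
    (hker : ∀ x : R, algebraMap R K x = 0 → ∃ y, x = p * y) {z : WeylRing R}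
    (hz : map R K z ∈ Subalgebra.center K (WeylRing K)) (b : WeylRing R) :
    (p : R) • (z * b) = (p : R) • (b * z) := by
  obtain ⟨y, hy⟩ : ∃ y, z * b - b * z = (p : R) • y := exists_eq_smul_of_map_eq_zero hker (by
    rw [map_sub, map_mul, map_mul, Subalgebra.mem_center_iff.1 hz, sub_self])
  rw [← sub_eq_zero, ← smul_sub, hy, smul_smul, ← sq, hp2, zero_smul]

theorem exists_pow_eq (hp : p.Prime) [CharP K p]
    (hsurj : Function.Surjective (algebraMap R K))
    (hker : ∀ x : R, algebraMap R K x = 0 → ∃ y, x = p * y) {P : WeylRing R}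
    (hP : (map R K P) ^ p ∈ Subalgebra.center K (WeylRing K)) :
    ∃ (U : R[X][X]) (E : WeylRing R), P ^ p = ofPoly R (expandPoly R p U) + (p : R) • E ∧
      nf ((map R K P) ^ p) = expandPoly K p (U.map (mapRingHom (algebraMap R K))) := by
  obtain ⟨f, hf⟩ := exists_expandPoly_eq_of_mem_center hp hP
  obtain ⟨U, rfl⟩ := Polynomial.map_surjective (mapRingHom (algebraMap R K))
    (Polynomial.map_surjective _ hsurj) f
  obtain ⟨E, hE⟩ := exists_eq_smul_of_map_eq_zero (p := p) hker
    (t := P ^ p - ofPoly R (expandPoly R p U)) (by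
      apply nf_injective
      rw [map_sub, map_sub, map_pow, hf, nf_map, nf_ofPoly, map_expandPoly, sub_self, map_zero])
  exact ⟨U, E, by rw [← hE]; abel, hf⟩

/-- A Weyl pair over a square-zero thickening of a field of characteristic `p` induces a pair of
bivariate polynomials with Jacobian determinant one on the centre. -/
theorem exists_jacobian_pair (hp : p.Prime) [CharP K p] (hp2 : (p : R) ^ 2 = 0)
    (hsurj : Function.Surjective (algebraMap R K))
    (hker : ∀ x : R, algebraMap R K x = 0 → ∃ y, x = p * y)
    (hann : ∀ x : R, p * x = 0 → algebraMap R K x = 0)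
    {P Q : WeylRing R} (h : Q * P = P * Q + 1) :
    ∃ U V : K[X][X], nf ((map R K P) ^ p) = expandPoly K p U ∧
      nf ((map R K Q) ^ p) = expandPoly K p V ∧
      ∀ N M, jacobianCoeff (coeffs V) (coeffs U) N M = if N = 1 ∧ M = 1 then 1 else 0 := by
  have h' : map R K Q * map R K P = map R K P * map R K Q + 1 := by
    rw [← map_mul, h, map_add, map_mul, map_one]
  have hPc := pow_char_mem_center hp h'
  have hQc := pow_char_mem_center' hp h'
  obtain ⟨U, E, hU, hU'⟩ := exists_pow_eq hp hsurj hker hPc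
  obtain ⟨V, F, hV, hV'⟩ := exists_pow_eq hp hsurj hker hQc
  refine ⟨_, _, hU', hV', fun N M => ?_⟩
  have hp2' : ((p : ℕ) : WeylRing R) ^ 2 = 0 := by
    rw [← map_natCast (algebraMap R (WeylRing R)), ← map_pow, hp2, map_zero]
  have hcomm := pow_prime_commutator h hp hp2'
  set a := ofPoly R (expandPoly R p U) with ha
  set b := ofPoly R (expandPoly R p V) with hb
  have hac : ∀ x, (p : R) • (a * x) = (p : R) • (x * a) :=
    smul_commute_of_map_mem_center hp2 hker (by
      have : map R K a = map R K P ^ p := nf_injective (by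
        rw [hU', ha, nf_map, nf_ofPoly, map_expandPoly])
      rw [this]; exact hPc)
  have hbc : ∀ x, (p : R) • (b * x) = (p : R) • (x * b) :=
    smul_commute_of_map_mem_center hp2 hker (by
      have : map R K b = map R K Q ^ p := nf_injective (by
        rw [hV', hb, nf_map, nf_ofPoly, map_expandPoly])
      rw [this]; exact hQc)
  -- The errors pE and pF do not affect the commutator: a and b are central modulo p, and the term
  -- with both errors carries p².
  have hba : b * a - a * b = (p.factorial : WeylRing R) := by
    rw [← sub_eq_iff_eq_add', hU, hV] at hcomm
    rw [← hcomm]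
    have h0 : ∀ x : WeylRing R, (p : R) • (p : R) • x = 0 := fun x => by
      rw [smul_smul, ← sq, hp2, zero_smul]
    have e1 : (b + (p : R) • F) * (a + (p : R) • E) - (a + (p : R) • E) * (b + (p : R) • F) =
        b * a - a * b + ((p : R) • (b * E) - (p : R) • (E * b)) +
          ((p : R) • (F * a) - (p : R) • (a * F)) +
          ((p : R) • (p : R) • (F * E) - (p : R) • (p : R) • (E * F)) := by
      rw [add_mul, add_mul, mul_add, mul_add, mul_add, mul_add, mul_smul_comm, mul_smul_comm,
        mul_smul_comm, mul_smul_comm, smul_mul_assoc, smul_mul_assoc, smul_mul_assoc,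
        smul_mul_assoc]
      abel
    rw [e1, h0, h0, hbc, hac, sub_self, sub_self, sub_self, add_zero, add_zero, add_zero]
  have key := coeffs_commutator_expandPoly hp hp2 V U N M
  rw [← ha, ← hb, hba] at key
  have e : u R ^ p * (p.factorial : WeylRing R) * v R ^ p =
      (p.factorial : R) • ofPoly R (expandPoly R p (monomial 1 (monomial 1 1))) := by
    rw [ofPoly_expandPoly_bimonomial, one_smul, pow_one, pow_one, ← Nat.cast_comm, mul_assoc,
      Nat.cast_smul_eq_nsmul, nsmul_eq_mul]
  rw [e, map_smul, nf_ofPoly] at key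
  have key2 : (p.factorial : R) * (if N = 1 ∧ M = 1 then 1 else 0) =
      (p.factorial : R) * jacobianCoeff (coeffs V) (coeffs U) N M := by
    rw [← key, coeffs, coeff_smul, coeff_smul, coeff_expandPoly hp.pos, smul_eq_mul,
      ← coeffs, coeffs_monomial]
    simp only [eq_comm]
  -- Writing p! = p (p - 1)!, the factor p is removed because its annihilator maps to zero in K;
  -- then (p - 1)! is a unit in K.
  have key3 := hann (((p - 1).factorial : R) * ((if N = 1 ∧ M = 1 then 1 else 0) -
      jacobianCoeff (coeffs V) (coeffs U) N M)) (by
    rw [← mul_assoc, ← Nat.cast_mul, Nat.mul_factorial_pred hp.ne_zero, mul_sub, key2, sub_self])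
  rw [map_mul, map_natCast, map_sub, mul_eq_zero] at key3
  have key4 := key3.resolve_left (by
    rw [CharP.cast_eq_zero_iff K p, hp.dvd_factorial]
    have := hp.pos
    omega)
  rw [sub_eq_zero] at key4
  rw [show coeffs (V.map (mapRingHom (algebraMap R K))) = fun i j => algebraMap R K (coeffs V i j) by
      funext i j; simp [coeffs],
    show coeffs (U.map (mapRingHom (algebraMap R K))) = fun i j => algebraMap R K (coeffs U i j) by
      funext i j; simp [coeffs], jacobianCoeff_map, ← key4]
  split_ifs <;> simp

end Jacobian

/-! ### Newton polygons of plane Jacobian pairs -/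

section Commutative

variable {k : Type*} [Field k]

/-- An extreme pair of exponents contributes a single term to the Jacobian. -/
theorem eq_one_of_extreme {U V : ℕ → ℕ → k}
    (H : ∀ N M, jacobianCoeff V U N M = if N = 1 ∧ M = 1 then 1 else 0) {b e a c : ℕ}
    (hU : U b e ≠ 0) (hV : V a c ≠ 0) (hdet : ((c * b : ℕ) - (a * e : ℕ) : k) ≠ 0)
    (hext : ∀ b' e' a' c', ((c' * b' : ℕ) - (a' * e' : ℕ) : k) ≠ 0 → U b' e' ≠ 0 → V a' c' ≠ 0 →
      a' + b' = a + b → c' + e' = c + e → b' = b ∧ e' = e) : a + b = 1 ∧ c + e = 1 := by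
  by_contra hne
  have h := H (a + b) (c + e)
  rw [if_neg hne, jacobianCoeff, Finset.sum_eq_single (a, b), Finset.sum_eq_single (c, e)] at h
  · exact mul_ne_zero hdet (mul_ne_zero hV hU) h
  · rintro ⟨y1, y2⟩ hy hne'
    by_contra h0
    rw [Finset.HasAntidiagonal.mem_antidiagonal] at hy
    simp only [mul_eq_zero, not_or] at h0 hy
    obtain ⟨h1, h2⟩ := hext b y2 a y1 h0.1 h0.2.2 h0.2.1 rfl hy
    exact hne' (by ext <;> simp <;> omega)
  · intro h; simp at h
  · rintro ⟨x1, x2⟩ hx hne'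
    refine Finset.sum_eq_zero fun ⟨y1, y2⟩ hy => ?_
    by_contra h0
    rw [Finset.HasAntidiagonal.mem_antidiagonal] at hx hy
    simp only [mul_eq_zero, not_or] at h0 hx hy
    obtain ⟨h1, h2⟩ := hext x2 y2 x1 y1 h0.1 h0.2.2 h0.2.1 hx hy
    exact hne' (by ext <;> simp <;> omega)
  · intro h; simp at h

/-- If the second member of a plane Jacobian pair of small degree is divisible by the second
variable, then it is a multiple of it. -/
theorem eq_of_jacobian_of_coeff_zero {p : ℕ} [CharP k p] {d : ℕ} (hd : d * d < p)
    {U V : ℕ → ℕ → k} (hU : ∀ i j, U i j ≠ 0 → i ≤ d ∧ j ≤ d)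
    (hV : ∀ i j, V i j ≠ 0 → i ≤ d ∧ j ≤ d) (hV0 : ∀ i, V i 0 = 0)
    (H : ∀ N M, jacobianCoeff V U N M = if N = 1 ∧ M = 1 then 1 else 0) {a c : ℕ}
    (hac : V a c ≠ 0) : a = 0 ∧ c = 1 := by
  classical
  have hcast : ∀ n : ℕ, 0 < n → n ≤ d * d → (n : k) ≠ 0 := fun n h0 h1 h => by
    rw [CharP.cast_eq_zero_iff k p] at h
    exact absurd (Nat.le_of_dvd h0 h) (by omega)
  have hVpos : ∀ i j, V i j ≠ 0 → 1 ≤ j := fun i j h => by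
    rcases j with _ | j
    · exact absurd (hV0 i) h
    · omega
  -- the restriction to the line
  obtain ⟨hU10, hV01, hUle, hVle⟩ : U 1 0 ≠ 0 ∧ V 0 1 ≠ 0 ∧ (∀ b, U b 0 ≠ 0 → b ≤ 1) ∧
      (∀ a, V a 1 ≠ 0 → a = 0) := by
    -- As V is divisible by y, a nonzero contribution to the coefficient of xy pairs the y-linear
    -- row of V with a nonconstant term of U(x, 0). The terms of highest x-degree in these two rows
    -- form an extreme pair, so U(x, 0) has degree one and the y-linear row of V is constant.
    have h11 := H 1 1
    rw [if_pos ⟨rfl, rfl⟩] at h11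
    obtain ⟨⟨x1, x2⟩, hx, h⟩ := Finset.exists_ne_zero_of_sum_ne_zero (h11.trans_ne one_ne_zero)
    obtain ⟨⟨y1, y2⟩, hy, h⟩ := Finset.exists_ne_zero_of_sum_ne_zero h
    rw [Finset.HasAntidiagonal.mem_antidiagonal] at hx hy
    simp only [mul_ne_zero_iff] at hx hy h
    have hy1 := hVpos _ _ h.2.1
    obtain rfl : y1 = 1 := by omega
    obtain rfl : y2 = 0 := by omega
    have hx2 : 1 ≤ x2 := by
      by_contra h0
      obtain rfl : x2 = 0 := by omega
      simp at h
    let SU := (Finset.range (d + 1)).filter fun b => U b 0 ≠ 0 ∧ 1 ≤ b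
    let SV := (Finset.range (d + 1)).filter fun a => V a 1 ≠ 0
    have hSU : ∀ b, U b 0 ≠ 0 → 1 ≤ b → b ∈ SU := fun b hb h1 =>
      Finset.mem_filter.2 ⟨Finset.mem_range.2 (Nat.lt_succ_of_le (hU b 0 hb).1), hb, h1⟩
    have hSV : ∀ b, V b 1 ≠ 0 → b ∈ SV := fun b hb =>
      Finset.mem_filter.2 ⟨Finset.mem_range.2 (Nat.lt_succ_of_le (hV b 1 hb).1), hb⟩
    obtain ⟨b, hb, hbmax⟩ := SU.exists_max_image id ⟨x2, hSU _ h.2.2 hx2⟩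
    obtain ⟨a, ha, hamax⟩ := SV.exists_max_image id ⟨x1, hSV _ h.2.1⟩
    rw [Finset.mem_filter] at ha hb
    have hbd := (hU _ _ hb.2.1).1
    have hdd : d ≤ d * d := Nat.le_mul_self d
    have hab := eq_one_of_extreme H hb.2.1 ha.2 (by
        simpa using hcast b hb.2.2 (by omega)) (by
      intro b' e' a' c' hdet hU' hV' h1 h2
      have := hVpos _ _ hV'
      obtain rfl : e' = 0 := by omega
      obtain rfl : c' = 1 := by omega
      have hb' : 1 ≤ b' := by
        by_contra h0
        obtain rfl : b' = 0 := by omega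
        simp at hdet
      have h3 := hbmax b' (hSU _ hU' hb')
      have h4 := hamax a' (hSV _ hV')
      simp only [id] at h3 h4
      exact ⟨by omega, rfl⟩)
    obtain rfl : b = 1 := by omega
    obtain rfl : a = 0 := by omega
    refine ⟨hb.2.1, ha.2, fun b hb => ?_, fun a ha => ?_⟩
    · by_contra h0
      have := hbmax b (hSU b hb (by omega))
      simp only [id] at this
      omega
    · have := hamax a (hSV a ha)
      simpa using this
  by_contra hbad
  have hc2 : 2 ≤ c := by
    have h1 := hVpos _ _ hac
    by_contra h2
    obtain rfl : c = 1 := by omega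
    exact hbad ⟨hVle a hac, rfl⟩
  -- the slope of the first edge
  let box := Finset.range (d + 1) ×ˢ Finset.range (d + 1)
  let SU := box.filter fun x => U x.1 x.2 ≠ 0
  let SV := box.filter fun x => V x.1 x.2 ≠ 0
  have hSU : ∀ x, x ∈ SU ↔ U x.1 x.2 ≠ 0 := fun x => by
    simp only [SU, box, Finset.mem_filter, Finset.mem_product, Finset.mem_range]
    exact ⟨fun h => h.2, fun h => ⟨by have := hU _ _ h; omega, h⟩⟩
  have hSV : ∀ x, x ∈ SV ↔ V x.1 x.2 ≠ 0 := fun x => by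
    simp only [SV, box, Finset.mem_filter, Finset.mem_product, Finset.mem_range]
    exact ⟨fun h => h.2, fun h => ⟨by have := hV _ _ h; omega, h⟩⟩
  -- The weight i - r j is at most 1 on a point of U, respectively at most -r on a point of V,
  -- exactly when r bounds the corresponding quotient. The largest quotient r makes both bounds
  -- hold, and one of them is attained away from the points (1, 0) of U and (0, 1) of V.
  let slopes : Finset ℚ :=
    (SU.filter fun x : ℕ × ℕ => 1 ≤ x.2).image (fun x : ℕ × ℕ => ((x.1 : ℚ) - 1) / x.2) ∪
    (SV.filter fun x : ℕ × ℕ => 2 ≤ x.2).image (fun x : ℕ × ℕ => (x.1 : ℚ) / (x.2 - 1))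
  have hmemV : ∀ x : ℕ × ℕ, V x.1 x.2 ≠ 0 → 2 ≤ x.2 → (x.1 : ℚ) / (x.2 - 1) ∈ slopes := fun x hx h2 =>
    Finset.mem_union_right _ (Finset.mem_image_of_mem _ (Finset.mem_filter.2 ⟨(hSV x).2 hx, h2⟩))
  have hmemU : ∀ x : ℕ × ℕ, U x.1 x.2 ≠ 0 → 1 ≤ x.2 → ((x.1 : ℚ) - 1) / x.2 ∈ slopes := fun x hx h2 =>
    Finset.mem_union_left _ (Finset.mem_image_of_mem _ (Finset.mem_filter.2 ⟨(hSU x).2 hx, h2⟩))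
  obtain ⟨r, hr, hrmax⟩ := slopes.exists_max_image id ⟨_, hmemV (a, c) hac hc2⟩
  simp only [id] at hrmax
  have hr0 : 0 ≤ r := by
    refine le_trans ?_ (hrmax _ (hmemV (a, c) hac hc2))
    have : (2 : ℚ) ≤ c := by exact_mod_cast hc2
    exact div_nonneg (Nat.cast_nonneg _) (by simp only; linarith)
  have hwU : ∀ b e, U b e ≠ 0 → (b : ℚ) - r * e ≤ 1 := by
    intro b e h
    rcases Nat.eq_zero_or_pos e with rfl | he
    · have : (b : ℚ) ≤ 1 := by exact_mod_cast hUle b h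
      simpa using this
    · have h1 := hrmax _ (hmemU (b, e) h he)
      have : (0 : ℚ) < e := by exact_mod_cast he
      rw [div_le_iff₀ this] at h1
      simp only at h1
      linarith
  have hwV : ∀ b e, V b e ≠ 0 → (b : ℚ) - r * e ≤ -r := by
    intro b e h
    rcases Nat.lt_or_ge e 2 with he | he
    · have := hVpos _ _ h
      obtain rfl : e = 1 := by omega
      rw [hVle b h]; simp
    · have h1 := hrmax _ (hmemV (b, e) h he)
      have : (2 : ℚ) ≤ e := by exact_mod_cast he
      rw [div_le_iff₀ (by simp only; linarith)] at h1
      simp only at h1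
      linarith
  -- the extreme points of the two edges
  obtain ⟨⟨b₁, e₁⟩, h1, h1max⟩ := (SU.filter fun x : ℕ × ℕ => (x.1 : ℚ) - r * x.2 = 1).exists_max_image
    (fun x => x.2) ⟨(1, 0), Finset.mem_filter.2 ⟨(hSU _).2 hU10, by simp⟩⟩
  obtain ⟨⟨a₁, c₁⟩, h2, h2max⟩ := (SV.filter fun x : ℕ × ℕ => (x.1 : ℚ) - r * x.2 = -r).exists_max_image
    (fun x => x.2) ⟨(0, 1), Finset.mem_filter.2 ⟨(hSV _).2 hV01, by simp⟩⟩
  rw [Finset.mem_filter, hSU] at h1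
  rw [Finset.mem_filter, hSV] at h2
  simp only at h1 h2
  have hUmax : ∀ b e, U b e ≠ 0 → (b : ℚ) - r * e = 1 → e ≤ e₁ := fun b e h h' =>
    h1max (b, e) (Finset.mem_filter.2 ⟨(hSU _).2 h, h'⟩)
  have hVmax : ∀ b e, V b e ≠ 0 → (b : ℚ) - r * e = -r → e ≤ c₁ := fun b e h h' =>
    h2max (b, e) (Finset.mem_filter.2 ⟨(hSV _).2 h, h'⟩)
  have hc1 := hVpos _ _ h2.1
  -- On the two edges b₁ = 1 + r e₁ and a₁ = r c₁ - r, so the determinant equals c₁ + r e₁ > 0. It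
  -- is also at most d² < p, hence nonzero in k.
  have hdet : a₁ * e₁ < c₁ * b₁ := by
    have : (a₁ * e₁ : ℚ) < c₁ * b₁ := by
      have e1 : (b₁ : ℚ) = 1 + r * e₁ := by linarith
      have e2 : (a₁ : ℚ) = r * c₁ - r := by linarith
      have e3 : (1 : ℚ) ≤ c₁ := by exact_mod_cast hc1
      have e4 : (0 : ℚ) ≤ r * e₁ := mul_nonneg hr0 (Nat.cast_nonneg _)
      rw [e1, e2]
      nlinarith
    exact_mod_cast this
  have hfin := eq_one_of_extreme H h1.1 h2.1 (by
      rw [← Nat.cast_sub hdet.le]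
      refine hcast _ (by omega) ?_
      have := Nat.mul_le_mul (hV _ _ h2.1).2 (hU _ _ h1.1).1
      omega) (by
    intro b' e' a' c' _ hU' hV' h3 h4
    have w1 := hwU _ _ hU'
    have w2 := hwV _ _ hV'
    have h3' : (a' : ℚ) + b' = a₁ + b₁ := by exact_mod_cast h3
    have h4' : (c' : ℚ) + e' = c₁ + e₁ := by exact_mod_cast h4
    have h5 : r * c' + r * e' = r * c₁ + r * e₁ := by rw [← mul_add, h4', mul_add]
    have m1 := hUmax _ _ hU' (by linarith)
    have m2 := hVmax _ _ hV' (by linarith)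
    obtain rfl : e' = e₁ := by omega
    refine ⟨?_, rfl⟩
    have : (b' : ℚ) = b₁ := by linarith
    exact_mod_cast this)
  obtain rfl : c₁ = 1 := by omega
  obtain rfl : e₁ = 0 := by omega
  -- The edge endpoints have collapsed to (1, 0) and (0, 1), but the point realising r lies higher
  -- on one of the edges.
  rcases Finset.mem_union.1 hr with hr | hr
  · obtain ⟨x, hx, hxr⟩ := Finset.mem_image.1 hr
    rw [Finset.mem_filter, hSU] at hx
    have hpos : (0 : ℚ) < x.2 := by exact_mod_cast hx.2
    rw [div_eq_iff hpos.ne'] at hxr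
    have := hUmax _ _ hx.1 (by linarith)
    omega
  · obtain ⟨x, hx, hxr⟩ := Finset.mem_image.1 hr
    rw [Finset.mem_filter, hSV] at hx
    have hpos : (2 : ℚ) ≤ x.2 := by exact_mod_cast hx.2
    rw [div_eq_iff (by linarith)] at hxr
    have := hVmax _ _ hx.1 (by linarith)
    omega

end Commutative

end WeylRing

/-! ### Specialising finitely generated rings to p-adic integers -/

section PadicSpecialization

/-- A nonconstant integer polynomial has values divisible by a prime not dividing a given
integer. -/
theorem Polynomial.exists_prime_dvd_eval_not_dvd (g : ℤ[X]) (hg : 0 < g.natDegree) {M : ℕ}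
    (hM : M ≠ 0) : ∃ (p : ℕ) (n : ℤ), p.Prime ∧ (p : ℤ) ∣ g.eval n ∧ ¬ p ∣ M := by
  by_cases h0 : g.eval 0 = 0
  · obtain ⟨p, hp, hprime⟩ := Nat.exists_infinite_primes (M + 1)
    refine ⟨p, 0, hprime, by rw [h0]; exact dvd_zero _, fun h => ?_⟩
    have := Nat.le_of_dvd (Nat.pos_of_ne_zero hM) h
    omega
  set c := g.eval 0 with hc
  have hne : ∀ a : ℤ, g - C a ≠ 0 := fun a h => by
    rw [sub_eq_zero.1 h, natDegree_C] at hg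
    exact lt_irrefl _ hg
  have hfin : Set.Finite {n : ℤ | g.eval n = c ∨ g.eval n = -c} := by
    have h : ∀ a : ℤ, Set.Finite {n : ℤ | g.eval n = a} := fun a =>
      ((g - C a).rootSet_finite ℤ).subset fun n hn => by
        rw [mem_rootSet]
        exact ⟨hne a, by simpa [sub_eq_zero] using hn⟩
    exact (h c).union (h (-c))
  have hinj : Function.Injective fun t : ℤ => c * M * t := fun s t h =>
    mul_left_cancel₀ (mul_ne_zero h0 (Nat.cast_ne_zero.2 hM)) h
  -- The value at c M t is c times an integer congruent to 1 modulo M. Since g takes the values ±c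
  -- only finitely often, some t makes this cofactor a non-unit, and its prime divisors are prime to
  -- M.
  obtain ⟨t, ht⟩ := Set.Infinite.nonempty
    ((hfin.preimage hinj.injOn).infinite_compl)
  obtain ⟨k, hk⟩ : c * M * t ∣ g.eval (c * M * t) - g.eval 0 := by
    simpa using sub_dvd_eval_sub (c * M * t) 0 g
  have hval : g.eval (c * M * t) = c * (1 + M * (t * k)) := by
    rw [← hc] at hk
    linear_combination hk
  have hunit : (1 + M * (t * k) : ℤ).natAbs ≠ 1 := fun h => by
    rcases Int.natAbs_eq (1 + M * (t * k) : ℤ) with h1 | h1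
    · rw [h] at h1
      exact ht (Or.inl (by rw [hval, h1]; simp))
    · rw [h] at h1
      exact ht (Or.inr (by rw [hval, h1]; simp))
  obtain ⟨p, hp, hdvd⟩ := Nat.exists_prime_and_dvd hunit
  have hdvd' : (p : ℤ) ∣ 1 + M * (t * k) := Int.natCast_dvd.2 hdvd
  refine ⟨p, _, hp, hval ▸ hdvd'.mul_left c, fun h => ?_⟩
  have h1 : (p : ℤ) ∣ 1 := by
    rw [dvd_add_left (Dvd.dvd.mul_right (Int.natCast_dvd_natCast.2 h) _)] at hdvd'
    exact hdvd'
  exact hp.one_lt.ne' (by exact_mod_cast Int.eq_one_of_dvd_one (by positivity) h1)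

theorem Polynomial.exists_map_int_eq_mul (q : ℚ[X]) :
    ∃ (n : ℤ) (q' : ℤ[X]), n ≠ 0 ∧ q'.map (Int.castRingHom ℚ) = C (n : ℚ) * q := by
  obtain ⟨b, hb, h⟩ := IsLocalization.integerNormalization_spec (nonZeroDivisors ℤ) q
  refine ⟨b, IsLocalization.integerNormalization (nonZeroDivisors ℤ) q,
    nonZeroDivisors.ne_zero hb, ?_⟩
  have : Int.castRingHom ℚ = algebraMap ℤ ℚ := rfl
  rw [this, h, zsmul_eq_mul]
  simp

/-- A number field embeds into `ℚ_[p]` for some `p` not dividing a given integer. -/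
theorem exists_ringHom_padic (L : Type*) [Field L] [Algebra ℚ L] [FiniteDimensional ℚ L] {M : ℕ}
    (hM : M ≠ 0) : ∃ (p : ℕ) (_ : Fact p.Prime), ¬ p ∣ M ∧ Nonempty (L →+* ℚ_[p]) := by
  let pb := Field.powerBasisOfFiniteOfSeparable ℚ L
  let m := minpoly ℚ pb.gen
  obtain ⟨a, b, hab⟩ : m.Separable := Algebra.IsSeparable.isSeparable ℚ pb.gen
  obtain ⟨n, g, hn, hg⟩ := exists_map_int_eq_mul m
  obtain ⟨na, a', hna, ha⟩ := exists_map_int_eq_mul a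
  obtain ⟨nb, b', hnb, hb⟩ := exists_map_int_eq_mul b
  have hdeg : 0 < g.natDegree := by
    have h1 : (g.map (Int.castRingHom ℚ)).natDegree = m.natDegree := by
      rw [hg, natDegree_C_mul (Int.cast_ne_zero.2 hn)]
    have h2 : 0 < m.natDegree := minpoly.natDegree_pos (IsIntegral.of_finite ℚ pb.gen)
    exact (h1 ▸ h2).trans_le natDegree_map_le
  -- An integral Bézout identity: a root of g modulo a prime not dividing the constant on the right
  -- is simple, so Hensel's lemma lifts it.
  have hbez : C nb * a' * g + C na * b' * derivative g = C (n * na * nb) := by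
    apply map_injective (Int.castRingHom ℚ) Int.cast_injective
    rw [Polynomial.map_add, Polynomial.map_mul, Polynomial.map_mul, Polynomial.map_mul,
      Polynomial.map_mul, ← derivative_map, hg, ha, hb, derivative_C_mul, map_C, map_C, map_C]
    simp only [eq_intCast, Int.cast_mul, C_mul]
    linear_combination (C (n : ℚ) * C (na : ℚ) * C (nb : ℚ)) * hab
  obtain ⟨p, x, hp, hx, hpM⟩ := g.exists_prime_dvd_eval_not_dvd hdeg
    (mul_ne_zero hM (Int.natAbs_ne_zero.2 (mul_ne_zero (mul_ne_zero hn hna) hnb)))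
  have : Fact p.Prime := ⟨hp⟩
  have hx' : ¬ (p : ℤ) ∣ (derivative g).eval x := fun h => by
    have h1 := congr_arg (eval x) hbez
    simp only [eval_add, eval_mul, eval_C] at h1
    refine hpM (Dvd.dvd.mul_left (Int.natCast_dvd.1 ?_) M)
    rw [← h1]
    exact dvd_add (hx.mul_left _) (h.mul_left _)
  have hev : ∀ f : ℤ[X], aeval (x : ℤ_[p]) f = ((f.eval x : ℤ) : ℤ_[p]) := fun f => by
    have := aeval_algebraMap_apply ℤ_[p] x f
    simpa using this
  have hnorm : ‖aeval (x : ℤ_[p]) g‖ < ‖aeval (x : ℤ_[p]) (derivative g)‖ ^ 2 := by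
    have h1 : ‖aeval (x : ℤ_[p]) (derivative g)‖ = 1 := by
      rw [hev]
      refine le_antisymm (PadicInt.norm_le_one _) (not_lt.1 fun h => hx' ?_)
      exact (PadicInt.norm_int_lt_one_iff_dvd _).1 h
    rw [h1, one_pow, hev]
    exact (PadicInt.norm_int_lt_one_iff_dvd _).2 hx
  obtain ⟨z, hz, -⟩ := hensels_lemma hnorm
  refine ⟨p, ‹_›, fun h => hpM (h.mul_right _), ⟨(pb.lift (z : ℚ_[p]) ?_).toRingHom⟩⟩
  have h1 : aeval (z : ℚ_[p]) (g.map (Int.castRingHom ℚ)) = 0 := by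
    have h2 : aeval (algebraMap ℤ_[p] ℚ_[p] z) g = 0 := by
      rw [aeval_algebraMap_apply, hz, map_zero]
    rw [← algebraMap_int_eq, aeval_map_algebraMap]
    exact h2
  rw [hg, map_mul, aeval_C, mul_eq_zero] at h1
  exact h1.resolve_left (by simpa using hn)

/-- Zariski's lemma: the quotient by a maximal ideal is finite over ℚ. -/
theorem exists_ringHom_numberField.{u} (A : Type u) [CommRing A] [Nontrivial A] [Algebra ℚ A]
    [Algebra.FiniteType ℚ A] : ∃ (L : Type u) (_ : Field L) (_ : Algebra ℚ L),
      FiniteDimensional ℚ L ∧ Nonempty (A →+* L) := by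
  obtain ⟨m, hm⟩ := Ideal.exists_maximal A
  let := Ideal.Quotient.field m
  exact ⟨A ⧸ m, inferInstance, inferInstance, finite_of_finite_type_of_isJacobsonRing ℚ (A ⧸ m),
    ⟨Ideal.Quotient.mk m⟩⟩

/-- A finitely generated subring of a field of characteristic zero maps to `ℤ_[p]` for arbitrarily
large `p`. -/
theorem exists_ringHom_padicInt {K : Type*} [Field K] [CharZero K] (T : Finset K) (B : ℕ) :
    ∃ (p : ℕ) (_ : Fact p.Prime), B < p ∧
      Nonempty (Algebra.adjoin ℤ (T : Set K) →+* ℤ_[p]) := by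
  classical
  have hft : Algebra.FiniteType ℚ (Algebra.adjoin ℚ (T : Set K)) :=
    (Algebra.adjoin ℚ (T : Set K)).fg_iff_finiteType.1 ⟨T, rfl⟩
  obtain ⟨L, _, _, hL, ⟨χ⟩⟩ := exists_ringHom_numberField (Algebra.adjoin ℚ (T : Set K))
  have hle : Algebra.adjoin ℤ (T : Set K) ≤ (Algebra.adjoin ℚ (T : Set K)).restrictScalars ℤ :=
    Algebra.adjoin_le Algebra.subset_adjoin
  let ψ : Algebra.adjoin ℤ (T : Set K) →+* L :=
    χ.comp (Subalgebra.inclusion hle).toRingHom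
  let S : Finset L := T.attach.image fun x => ψ ⟨x.1, Algebra.subset_adjoin x.2⟩
  have halg : Algebra.IsAlgebraic ℤ L :=
    (IsFractionRing.comap_isAlgebraic_iff (A := ℤ) (K := ℚ) (C := L)).2 (Algebra.IsAlgebraic.of_finite ℚ L)
  obtain ⟨y, hy, hS⟩ := Algebra.IsAlgebraic.exists_integral_multiples ℤ S
  -- Avoiding the divisors of B! forces p > B; avoiding those of the common denominator y makes y a
  -- p-adic unit, so the images of the generators are p-adic integers.
  obtain ⟨p, hp, hpM, ⟨φ⟩⟩ := exists_ringHom_padic L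
    (mul_ne_zero B.factorial_ne_zero (Int.natAbs_ne_zero.2 hy))
  refine ⟨p, hp, ?_, ⟨?_⟩⟩
  · by_contra h
    exact hpM (Dvd.dvd.mul_right ((hp.out.dvd_factorial).2 (not_lt.1 h)) _)
  have hbound : ∀ x ∈ S, ‖φ x‖ ≤ 1 := by
    intro x hx
    have h1 : IsIntegral ℤ (φ (y • x)) := (hS x hx).map φ.toIntAlgHom
    have h2 : IsIntegral ℤ_[p] (φ (y • x)) := h1.tower_top
    obtain ⟨w, hw⟩ := IsIntegrallyClosed.isIntegral_iff.1 h2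
    have h3 : ‖φ (y • x)‖ ≤ 1 := by rw [← hw]; exact PadicInt.norm_le_one w
    rw [zsmul_eq_mul, map_mul, map_intCast, norm_mul] at h3
    have h4 : ‖(y : ℚ_[p])‖ = 1 := by
      refine le_antisymm (Padic.norm_int_le_one y) (not_lt.1 fun h => hpM ?_)
      have h5 : ‖(y : ℤ_[p])‖ < 1 := by rw [PadicInt.norm_def]; simpa using h
      exact (Int.natCast_dvd.1 ((PadicInt.norm_int_lt_one_iff_dvd y).1 h5)).mul_left _
    rwa [h4, one_mul] at h3
  have hmem : ∀ x, (φ.comp ψ) x ∈ PadicInt.subring p := by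
    rintro ⟨x, hx⟩
    induction hx using Algebra.adjoin_induction with
    | mem x hx =>
      refine hbound _ ?_
      simp only [S, Finset.mem_image, Finset.mem_attach, true_and]
      exact ⟨⟨x, hx⟩, rfl⟩
    | algebraMap n =>
      have : (⟨algebraMap ℤ K n, Subalgebra.algebraMap_mem _ n⟩ :
          Algebra.adjoin ℤ (T : Set K)) = (n : Algebra.adjoin ℤ (T : Set K)) := by
        ext; simp
      rw [this, map_intCast]
      exact intCast_mem _ n
    | add x y hx hy h1 h2 =>
      have e := map_add (φ.comp ψ) ⟨x, hx⟩ ⟨y, hy⟩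
      exact e ▸ add_mem h1 h2
    | mul x y hx hy h1 h2 =>
      have e := map_mul (φ.comp ψ) ⟨x, hx⟩ ⟨y, hy⟩
      exact e ▸ mul_mem h1 h2
  exact (φ.comp ψ).codRestrict (PadicInt.subring p) hmem

end PadicSpecialization

/-! ### Skew members of Weyl pairs modulo p -/

namespace WeylRing

section Reduction

/-- `flip` fixes u^p and, p being odd, negates the central element v^p; terms free of v^p are
therefore unchanged. -/
theorem flip_ofPoly_expandPoly {k : Type*} [Field k] {p : ℕ} [CharP k p] (hp2 : Odd p)
    (hp : p.Prime) (V : k[X][X]) (i : ℕ) :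
    coeffs (nf (flip (ofPoly k (expandPoly k p V))).unop) (i * p) 0 = coeffs V i 0 := by
  induction V using induction_bimonomial with
  | add V V' h h' =>
    rw [coeffs_add, ← h, ← h', map_add (expandPoly k p), map_add (ofPoly k), map_add,
      MulOpposite.unop_add, map_add nf, coeffs_add]
  | mono a c r =>
    have h1 : (flip (u k)).unop = u k := by simp [flip]
    have h2 : (flip (v k)).unop = -v k := by simp [flip]
    have hc := Subalgebra.mem_center_iff.1 (pow_mem (v_pow_char_mem_center k p) c)
    have e : (flip (ofPoly k (expandPoly k p (monomial a (monomial c r))))).unop =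
        ofPoly k (expandPoly k p (monomial a (monomial c ((-1) ^ c * r)))) := by
      rw [ofPoly_expandPoly_bimonomial, ofPoly_expandPoly_bimonomial, map_smul, map_mul, map_pow,
        map_pow, map_pow, map_pow, MulOpposite.unop_smul, MulOpposite.unop_mul,
        MulOpposite.unop_pow, MulOpposite.unop_pow, MulOpposite.unop_pow, MulOpposite.unop_pow,
        h1, h2, hp2.neg_pow, neg_pow (v k ^ p), mul_assoc, ← hc, mul_comm _ r, mul_smul]
      congr 1
      rcases Nat.even_or_odd c with hc' | hc'
      · simp [hc'.neg_one_pow]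
      · simp [hc'.neg_one_pow]
    rw [e, nf_ofPoly]
    have := coeff_expandPoly hp.pos (monomial a (monomial c ((-1) ^ c * r))) i 0
    rw [zero_mul] at this
    rw [coeffs, this, ← coeffs, coeffs_monomial, coeffs_monomial]
    rcases c with _ | c
    · simp
    · simp

theorem coeffs_bound_of_pow {k : Type*} [Field k] {p : ℕ} (hp : p.Prime) {P : WeylRing k} {d : ℕ}
    (h1 : (nf P).natDegree ≤ d) (h2 : VDegreeLE d P) {U : k[X][X]}
    (hU : nf (P ^ p) = expandPoly k p U) (i j : ℕ) (h : coeffs U i j ≠ 0) : i ≤ d ∧ j ≤ d := by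
  rw [coeffs, ← coeff_expandPoly hp.pos, ← hU] at h
  have hi : i * p ≤ p * d := by
    by_contra h0
    refine h ?_
    rw [coeff_eq_zero_of_natDegree_lt (lt_of_le_of_lt (nf_pow_top P h1 p).1 (not_le.1 h0)),
      coeff_zero]
  have hj : j * p ≤ p * d := by
    by_contra h0
    exact h (coeff_eq_zero_of_natDegree_lt (lt_of_le_of_lt (h2.pow p _) (not_le.1 h0)))
  rw [mul_comm] at hi hj
  exact ⟨Nat.le_of_mul_le_mul_left hi hp.pos, Nat.le_of_mul_le_mul_left hj hp.pos⟩

/-- The reduction of a skew element of a Weyl pair of small degree is affine in `v`. -/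
theorem affine_of_flip_eq_neg {R k : Type*} [CommRing R] [Field k] [Algebra R k] {p : ℕ}
    (hp : p.Prime) (hp_odd : Odd p) [CharP k p] (hp2 : (p : R) ^ 2 = 0)
    (hsurj : Function.Surjective (algebraMap R k))
    (hker : ∀ x : R, algebraMap R k x = 0 → ∃ y, x = p * y)
    (hann : ∀ x : R, p * x = 0 → algebraMap R k x = 0)
    {P Q : WeylRing R} (h : Q * P = P * Q + 1) (hQ : (flip Q).unop = -Q) {d : ℕ} (hd : d * d < p)
    (hP1 : (nf (map R k P)).natDegree ≤ d) (hP2 : VDegreeLE d (map R k P))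
    (hQ1 : (nf (map R k Q)).natDegree ≤ d) (hQ2 : VDegreeLE d (map R k Q)) {a c : ℕ}
    (hac : coeffs (nf (map R k Q)) a c ≠ 0) : a = 0 ∧ c ≤ 1 := by
  obtain ⟨U, V, hU, hV, H⟩ := exists_jacobian_pair hp hp2 hsurj hker hann h
  have hflip : (flip (map R k Q ^ p)).unop = -(map R k Q ^ p) := by
    rw [map_pow, MulOpposite.unop_pow, flip_map, hQ, map_neg, hp_odd.neg_pow]
  -- Q^p is skew because p is odd, while `flip` preserves the part of V free of y; that part equals
  -- its negative.
  have hV0 : ∀ i, coeffs V i 0 = 0 := fun i => by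
    have h1 := flip_ofPoly_expandPoly hp_odd hp V i
    rw [← hV, ofPoly_nf, hflip, map_neg, hV, coeffs, coeff_neg, coeff_neg] at h1
    have h2 := coeff_expandPoly hp.pos V i 0
    rw [zero_mul] at h2
    rw [h2, ← coeffs] at h1
    have h3 : (2 : k) * coeffs V i 0 = 0 := by linear_combination -h1
    refine (mul_eq_zero.1 h3).resolve_left fun h4 => ?_
    have h5 : ((2 : ℕ) : k) = 0 := by exact_mod_cast h4
    rw [CharP.cast_eq_zero_iff k p] at h5
    have := Nat.le_of_dvd two_pos h5
    have := hp.two_le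
    obtain ⟨t, ht⟩ := hp_odd
    omega
  have hV1 : ∀ i j, coeffs V i j ≠ 0 → i = 0 ∧ j = 1 := fun i j hij =>
    eq_of_jacobian_of_coeff_zero hd (coeffs_bound_of_pow hp hP1 hP2 hU)
      (coeffs_bound_of_pow hp hQ1 hQ2 hV) hV0 H hij
  set q := nf (map R k Q) with hq
  have hcoeff : ∀ m, (nf (map R k Q ^ p)).coeff (p * m) = expand k p (V.coeff m) := fun m => by
    rw [hV, mul_comm]
    simp [expandPoly, coeff_expand_mul hp.pos]
  -- The top coefficient of Q^p in u is the p-th power of that of Q, so a positive u-degree of Q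
  -- would be visible in V. The same comparison then bounds the v-degree.
  have hdeg : q.natDegree = 0 := by
    by_contra h0
    have h1 := (nf_pow_top (map R k Q) le_rfl p).2
    have h2 : V.coeff q.natDegree = 0 := by
      ext j
      by_contra h3
      exact h0 (hV1 _ _ h3).1
    rw [← hq, hcoeff, h2, map_zero] at h1
    have h4 := leadingCoeff_eq_zero.1 ((pow_eq_zero_iff hp.ne_zero).1 h1.symm)
    exact h0 (by rw [h4, natDegree_zero])
  have hdeg0 : (q.coeff 0).natDegree ≤ 1 := by
    have h1 := (nf_pow_top (map R k Q) hdeg.le p).2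
    rw [hcoeff] at h1
    have h2 := congr_arg natDegree h1
    rw [natDegree_expand, natDegree_pow, mul_comm, Nat.mul_right_inj hp.ne_zero] at h2
    rw [hq, ← h2, natDegree_le_iff_coeff_eq_zero]
    intro j hj
    by_contra h3
    have := (hV1 _ _ h3).2
    omega
  have ha : a = 0 := by
    by_contra h0
    have h1 : q.coeff a = 0 := coeff_eq_zero_of_natDegree_lt (by omega)
    exact hac (by rw [coeffs, h1, coeff_zero])
  subst ha
  refine ⟨rfl, ?_⟩
  by_contra h0
  exact hac (coeff_eq_zero_of_natDegree_lt (by omega))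

end Reduction

/-! ### Lifting to characteristic zero and inverting the endomorphism -/

section CharZero

theorem map_injective {R S : Type*} [CommRing R] [CommRing S] [Algebra R S]
    (h : Function.Injective (algebraMap R S)) : Function.Injective (map R S) := fun a b hab =>
  nf_injective <| Polynomial.map_injective (mapRingHom (algebraMap R S))
    (Polynomial.map_injective _ h) (by rw [← nf_map, ← nf_map, hab])

theorem exists_map_eq {R S : Type*} [CommRing R] [CommRing S] [Algebra R S] (a : WeylRing S)
    (h : ∀ i j, coeffs (nf a) i j ∈ Set.range (algebraMap R S)) : ∃ b, map R S b = a := by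
  obtain ⟨f, hf⟩ : nf a ∈ lifts (mapRingHom (algebraMap R S)) := by
    rw [lifts_iff_coeff_lifts]
    intro i
    have : (nf a).coeff i ∈ lifts (algebraMap R S) := by
      rw [lifts_iff_coeff_lifts]
      exact h i
    obtain ⟨g, hg⟩ := this
    exact ⟨g, hg⟩
  refine ⟨ofPoly R f, nf_injective ?_⟩
  rw [nf_map, nf_ofPoly]
  exact hf

theorem exists_vDegreeLE {R : Type*} [CommRing R] (a : WeylRing R) : ∃ d, VDegreeLE d a := by
  refine ⟨(nf a).support.sup fun i => ((nf a).coeff i).natDegree, fun i => ?_⟩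
  by_cases hi : i ∈ (nf a).support
  · exact Finset.le_sup (f := fun i => ((nf a).coeff i).natDegree) hi
  · rw [notMem_support_iff.1 hi, natDegree_zero]
    exact Nat.zero_le _

/-- The finitely many coefficients of a bivariate polynomial. -/
noncomputable def coeffSet {R : Type*} [CommRing R] [DecidableEq R] (f : R[X][X]) : Finset R :=
  insert 0 (f.support.biUnion fun i => (f.coeff i).support.image fun j => coeffs f i j)

theorem coeffs_mem_coeffSet {R : Type*} [CommRing R] [DecidableEq R] (f : R[X][X]) (i j : ℕ) :
    coeffs f i j ∈ coeffSet f := by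
  by_cases h : coeffs f i j = 0
  · rw [h]; exact Finset.mem_insert_self _ _
  · refine Finset.mem_insert_of_mem (Finset.mem_biUnion.2 ⟨i, ?_, Finset.mem_image.2 ⟨j, ?_, rfl⟩⟩)
    · rw [mem_support_iff]
      intro h0
      exact h (by rw [coeffs, h0, coeff_zero])
    · rwa [mem_support_iff]

theorem natDegree_nf_map_le {R S : Type*} [CommRing R] [CommRing S] [Algebra R S] {d : ℕ}
    {a : WeylRing R} (h : (nf a).natDegree ≤ d) : (nf (map R S a)).natDegree ≤ d := by
  rw [nf_map]
  exact natDegree_map_le.trans h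

theorem VDegreeLE.map {R S : Type*} [CommRing R] [CommRing S] [Algebra R S] {d : ℕ}
    {a : WeylRing R} (h : VDegreeLE d a) : VDegreeLE d (map R S a) := fun i => by
  rw [nf_map, coeff_map]
  exact natDegree_map_le.trans (h i)

theorem coeffs_nf_affine {K : Type*} [Field K] [CharZero K] {P Q : WeylRing K}
    (h : Q * P = P * Q + 1) (hQ : (flip Q).unop = -Q) {a c : ℕ}
    (hac : coeffs (nf Q) a c ≠ 0) : a = 0 ∧ c ≤ 1 := by
  classical
  -- Adjoining the inverse of the chosen coefficient keeps that coefficient nonzero after reduction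
  -- modulo p.
  let T : Finset K := insert (coeffs (nf Q) a c)⁻¹ (coeffSet (nf P) ∪ coeffSet (nf Q))
  let R₀ := Algebra.adjoin ℤ (T : Set K)
  have hT : ∀ x ∈ T, x ∈ Set.range (algebraMap R₀ K) := fun x hx =>
    ⟨⟨x, Algebra.subset_adjoin hx⟩, rfl⟩
  have hinj : Function.Injective (algebraMap R₀ K) := Subtype.val_injective
  obtain ⟨P₀, hP⟩ := exists_map_eq (R := R₀) P fun i j => hT _ (Finset.mem_insert_of_mem
    (Finset.mem_union_left _ (coeffs_mem_coeffSet _ i j)))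
  obtain ⟨Q₀, hQ'⟩ := exists_map_eq (R := R₀) Q fun i j => hT _ (Finset.mem_insert_of_mem
    (Finset.mem_union_right _ (coeffs_mem_coeffSet _ i j)))
  obtain ⟨t, ht⟩ := hT _ (Finset.mem_insert_self _ _)
  have hinv : coeffs (nf Q₀) a c * t = 1 := by
    apply hinj
    rw [map_mul, ht, map_one, coeffs, ← coeff_nf_map, hQ', ← coeffs, mul_inv_cancel₀ hac]
  have h₀ : Q₀ * P₀ = P₀ * Q₀ + 1 := by
    apply map_injective hinj
    rw [map_mul, map_add, map_mul, map_one, hP, hQ', h]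
  have hQ₀ : (flip Q₀).unop = -Q₀ := by
    apply map_injective hinj
    rw [← flip_map, hQ', hQ, map_neg, hQ']
  obtain ⟨d₁, hd₁⟩ := exists_vDegreeLE P₀
  obtain ⟨d₂, hd₂⟩ := exists_vDegreeLE Q₀
  obtain ⟨d, hdP, hdQ, hd₁', hd₂'⟩ : ∃ d, (nf P₀).natDegree ≤ d ∧ (nf Q₀).natDegree ≤ d ∧
      d₁ ≤ d ∧ d₂ ≤ d :=
    ⟨(nf P₀).natDegree + (nf Q₀).natDegree + d₁ + d₂, by omega, by omega, by omega, by omega⟩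
  -- The bound gives both d² < p and p ≠ 2.
  obtain ⟨p, hp, hB, ⟨φ⟩⟩ := exists_ringHom_padicInt T (d * d + 2)
  let g : R₀ →+* ZMod (p ^ 2) := (PadicInt.toZModPow 2).comp φ
  let : Algebra R₀ (ZMod (p ^ 2)) := g.toAlgebra
  let : Algebra (ZMod (p ^ 2)) (ZMod p) :=
    (ZMod.castHom (dvd_pow_self p two_ne_zero) (ZMod p)).toAlgebra
  have hmap : ∀ n : ℕ, algebraMap (ZMod (p ^ 2)) (ZMod p) n = n := fun n => map_natCast _ n
  have : NeZero (p ^ 2) := ⟨pow_ne_zero _ hp.out.ne_zero⟩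
  have hker : ∀ x : ZMod (p ^ 2), algebraMap (ZMod (p ^ 2)) (ZMod p) x = 0 →
      ∃ y, x = (p : ZMod (p ^ 2)) * y := by
    intro x hx
    rw [← ZMod.natCast_zmod_val x, hmap, ZMod.natCast_eq_zero_iff] at hx
    obtain ⟨y, hy⟩ := hx
    exact ⟨y, by rw [← ZMod.natCast_zmod_val x, hy, Nat.cast_mul]⟩
  have hann : ∀ x, (p : ZMod (p ^ 2)) * x = 0 →
      algebraMap (ZMod (p ^ 2)) (ZMod p) x = 0 := by
    intro x hx
    rw [← ZMod.natCast_zmod_val x, ← Nat.cast_mul, ZMod.natCast_eq_zero_iff] at hx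
    rw [← ZMod.natCast_zmod_val x, hmap, ZMod.natCast_eq_zero_iff]
    exact Nat.dvd_of_mul_dvd_mul_left hp.out.pos ((sq p).symm.dvd.trans hx)
  refine affine_of_flip_eq_neg (R := ZMod (p ^ 2)) (k := ZMod p) hp.out
    (hp.out.odd_of_ne_two (by omega)) (by
      rw [← Nat.cast_pow, ZMod.natCast_self]) (ZMod.ringHom_surjective _) hker hann
    (P := map R₀ _ P₀) (Q := map R₀ _ Q₀) (by rw [← map_mul, h₀, map_add, map_mul, map_one])
    (by rw [flip_map, hQ₀, map_neg]) (d := d) (by omega)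
    (natDegree_nf_map_le (natDegree_nf_map_le hdP)) ((hd₁.mono hd₁').map.map)
    (natDegree_nf_map_le (natDegree_nf_map_le hdQ)) ((hd₂.mono hd₂').map.map) ?_
  rw [coeffs, coeff_nf_map, coeff_nf_map]
  intro h0
  have h1 := congr_arg (fun x => algebraMap (ZMod (p ^ 2)) (ZMod p) (algebraMap R₀ _ x)) hinv
  simp only [map_mul, map_one] at h1
  rw [coeffs, h0, zero_mul] at h1
  exact zero_ne_one h1

/-- Affinity leaves only a multiple of v and a constant; `flip` fixes constants, so skewness kills
the latter. -/
theorem eq_smul_v {K : Type*} [Field K] [CharZero K] {P Q : WeylRing K}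
    (h : Q * P = P * Q + 1) (hQ : (flip Q).unop = -Q) : ∃ c : K, Q = c • v K := by
  have hcoeff := fun a c => coeffs_nf_affine h hQ (a := a) (c := c)
  have h1 : nf Q = C ((nf Q).coeff 0) := by
    ext i j
    rw [coeff_C]
    split_ifs with hi
    · rw [hi]
    · by_contra h0
      exact hi (hcoeff i j h0).1
  have h2 : ((nf Q).coeff 0).natDegree ≤ 1 := by
    rw [natDegree_le_iff_coeff_eq_zero]
    intro j hj
    by_contra h0
    exact absurd (hcoeff 0 j h0).2 (by omega)
  obtain ⟨c, e, hce⟩ := exists_eq_X_add_C_of_natDegree_le_one h2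
  have h3 : Q = c • v K + e • 1 := by
    rw [← ofPoly_nf Q, h1, hce, ← monomial_zero_left, ofPoly_monomial]
    simp [Algebra.smul_def]
  refine ⟨c, ?_⟩
  have h4 : (flip Q).unop = -(c • v K) + e • 1 := by
    rw [h3]; simp [flip]
  have h5 : (2 * e) • (1 : WeylRing K) = 0 := by
    rw [h4, h3] at hQ
    have : e • (1 : WeylRing K) + e • 1 = 0 := by
      rw [neg_add, add_right_inj] at hQ
      nth_rewrite 1 [hQ]
      exact neg_add_cancel _
    rw [two_mul, add_smul, this]
  have h6 : e = 0 := by simpa using h5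
  rw [h3, h6, zero_smul, add_zero]

/-- An endomorphism of the Weyl algebra commuting with the involution `u ↦ u`, `v ↦ -v` is an
automorphism. -/
theorem bijective_of_flip_comm {K : Type*} [Field K] [CharZero K]
    (f : WeylRing K →ₐ[K] WeylRing K) (hf : ∀ a, f (flip a).unop = (flip (f a)).unop) :
    Function.Bijective f := by
  have hrel : f (v K) * f (u K) = f (u K) * f (v K) + 1 := by
    rw [← map_mul, v_mul_u, map_add, map_mul, map_one]
  obtain ⟨c, hc⟩ := eq_smul_v hrel (by
    rw [← hf]; simp [flip])
  -- With Q = c v, the relation [Q, P] = 1 says that the u-derivative of P is c⁻¹, so P is c⁻¹ u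
  -- plus a polynomial in v.
  have h1 : c • derivative (nf (f (u K))) = 1 := by
    rw [← nf_v_commutator, ← map_smul, smul_sub, ← smul_mul_assoc, ← mul_smul_comm, ← hc, hrel,
      add_sub_cancel_left, nf_one]
  have hc0 : c ≠ 0 := by
    rintro rfl
    rw [zero_smul] at h1
    exact zero_ne_one h1
  obtain ⟨b, hb⟩ : ∃ b : K[X], f (u K) = c⁻¹ • u K + aeval (v K) b := by
    refine ⟨(nf (f (u K))).coeff 0, nf_injective ?_⟩
    have e1 : nf (u K) = X := by simpa using nf_u_mul (1 : WeylRing K)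
    have e2 : nf (aeval (v K) ((nf (f (u K))).coeff 0)) = C ((nf (f (u K))).coeff 0) := by
      simpa using nf_mul_aeval_v (1 : WeylRing K) ((nf (f (u K))).coeff 0)
    rw [map_add, map_smul, e1, e2]
    have h2 : derivative (nf (f (u K)) - c⁻¹ • X) = 0 := by
      rw [derivative_sub, derivative_smul, derivative_X, ← h1, smul_smul, inv_mul_cancel₀ hc0,
        one_smul, sub_self]
    have h3 := eq_C_of_derivative_eq_zero h2
    rw [coeff_sub, coeff_smul, coeff_X_zero, smul_zero, sub_zero] at h3
    rw [← h3, add_sub_cancel]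
  let g : WeylRing K →ₐ[K] WeylRing K :=
    lift (c • u K - c • aeval (c⁻¹ • v K) b) (c⁻¹ • v K) (by
      have h2 : Commute (c⁻¹ • v K) (aeval (c⁻¹ • v K) b) := by
        have := (Commute.all X b).map (aeval (R := K) (c⁻¹ • v K))
        rwa [aeval_X] at this
      rw [mul_sub, sub_mul, mul_smul_comm, mul_smul_comm, h2.eq, smul_mul_smul_comm,
        smul_mul_assoc c, smul_mul_assoc c⁻¹, smul_smul, v_mul_u, mul_inv_cancel₀ hc0, one_smul,
        one_smul]
      abel)
  have hgu : g (u K) = c • u K - c • aeval (c⁻¹ • v K) b := lift_u _ _ _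
  have hgv : g (v K) = c⁻¹ • v K := lift_v _ _ _
  have hgf : g.comp f = AlgHom.id K _ := by
    apply algHom_ext
    · rw [AlgHom.comp_apply, hb, map_add, map_smul, hgu, ← aeval_algHom_apply, hgv, smul_sub,
        smul_smul, smul_smul, inv_mul_cancel₀ hc0, one_smul, one_smul, sub_add_cancel]
      rfl
    · rw [AlgHom.comp_apply, hc, map_smul, hgv, smul_smul, mul_inv_cancel₀ hc0, one_smul]
      rfl
  have hfg : f.comp g = AlgHom.id K _ := by
    apply algHom_ext
    · rw [AlgHom.comp_apply, hgu, map_sub, map_smul, map_smul, ← aeval_algHom_apply, map_smul, hc,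
        hb, smul_smul, inv_mul_cancel₀ hc0, one_smul, smul_add, smul_smul, mul_inv_cancel₀ hc0,
        one_smul, add_sub_cancel_right]
      rfl
    · rw [AlgHom.comp_apply, hgv, map_smul, hc, smul_smul, inv_mul_cancel₀ hc0, one_smul]
      rfl
  exact ⟨Function.LeftInverse.injective fun x => DFunLike.congr_fun hgf x,
    Function.RightInverse.surjective fun x => DFunLike.congr_fun hfg x⟩

end CharZero

end WeylRing

/-! ### Involutions and their conjugates -/

namespace WeylAlgebra

section

variable {K : Type*} [Field K]

theorem algHom_ext {A : Type*} [Semiring A] [Algebra K A] {f g : WeylAlgebra K →ₐ[K] A}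
    (hX : f (X K) = g (X K)) (hY : f (Y K) = g (Y K)) : f = g := by
  refine RingQuot.ringQuot_ext' K f g ?_
  apply FreeAlgebra.hom_ext
  funext i
  fin_cases i
  · exact hX
  · exact hY

theorem op_alpha (a : WeylAlgebra K) : MulOpposite.op (alpha K a) = alphaOp K a := rfl

theorem alpha_alpha (a : WeylAlgebra K) : alpha K (alpha K a) = a := by
  have h : ((AlgEquiv.opOp K (WeylAlgebra K)).symm.toAlgHom.comp
      ((AlgHom.op (alphaOp K)).comp (alphaOp K))) = AlgHom.id K (WeylAlgebra K) := by
    apply algHom_ext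
    · change alpha K (alpha K (X K)) = X K
      rw [alpha_X, alpha_Y]
    · change alpha K (alpha K (Y K)) = Y K
      rw [alpha_Y, alpha_X]
  exact DFunLike.congr_fun h a

theorem alpha_bijective : Function.Bijective (alpha K) :=
  Function.Involutive.bijective alpha_alpha

theorem isInvolution_alpha : IsInvolution (alpha K) where
  map_one := MulOpposite.op_injective (by rw [op_alpha, map_one, MulOpposite.op_one])
  map_mul_rev a b := MulOpposite.op_injective (by
    rw [op_alpha, map_mul, MulOpposite.op_mul, op_alpha, op_alpha])
  involutive := alpha_alpha

/-- If g is an anti-automorphism, then α ∘ g is an automorphism that also intertwines γ with α. -/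
theorem IsConjugateToAlpha.exists_algEquiv {γ : WeylAlgebra K →ₗ[K] WeylAlgebra K}
    (h : IsConjugateToAlpha γ) :
    ∃ g : WeylAlgebra K ≃ₐ[K] WeylAlgebra K, ∀ a, g (γ a) = alpha K (g a) := by
  rcases h with ⟨g, hg⟩ | ⟨g, hg⟩
  · exact ⟨g, fun a => by rw [hg, AlgEquiv.apply_symm_apply]⟩
  · let g' : WeylAlgebra K →ₐ[K] WeylAlgebra K :=
      (AlgEquiv.opOp K (WeylAlgebra K)).symm.toAlgHom.comp
        ((AlgHom.op (alphaOp K)).comp g.toAlgHom)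
    have hg' : ∀ a, g' a = alpha K (MulOpposite.unop (g a)) := fun a => rfl
    have hbij : Function.Bijective g' :=
      alpha_bijective.comp (MulOpposite.unop_bijective.comp g.bijective)
    refine ⟨AlgEquiv.ofBijective g' hbij, fun a => ?_⟩
    rw [AlgEquiv.ofBijective_apply, AlgEquiv.ofBijective_apply, hg', hg', hg,
      AlgEquiv.apply_symm_apply, MulOpposite.unop_op]

/-- Take γ = α and δ = f ∘ α ∘ f⁻¹. -/
theorem exists_involutions_of_bijective (f : WeylAlgebra K →ₐ[K] WeylAlgebra K)
    (hf : Function.Bijective f) : ∃ γ δ : WeylAlgebra K →ₗ[K] WeylAlgebra K,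
      IsInvolution γ ∧ IsInvolution δ ∧ IsInvolutiveEndomorphism γ δ f := by
  let e := AlgEquiv.ofBijective f hf
  have he : ∀ a, e.symm (f a) = a := e.symm_apply_apply
  refine ⟨alpha K, f.toLinearMap ∘ₗ alpha K ∘ₗ e.symm.toLinearMap, isInvolution_alpha,
    ⟨?_, fun a b => ?_, fun a => ?_⟩, fun a => ?_⟩
  · change f (alpha K (e.symm 1)) = 1
    rw [map_one, isInvolution_alpha.map_one, map_one]
  · change f (alpha K (e.symm (a * b))) = f (alpha K (e.symm b)) * f (alpha K (e.symm a))
    rw [map_mul, isInvolution_alpha.map_mul_rev, map_mul]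
  · change f (alpha K (e.symm (f (alpha K (e.symm a))))) = a
    rw [he, alpha_alpha]
    exact e.apply_symm_apply a
  · change f (alpha K a) = f (alpha K (e.symm (f a)))
    rw [he]

end

/-! ### Reduction to coordinates in which the involution is diagonal -/

section

variable {K : Type*} [Field K] [CharZero K]

/-- The coordinate change `X ↦ u / 2 - v`, `Y ↦ u / 2 + v`. -/
noncomputable def toWeylRing (K : Type*) [Field K] [CharZero K] :
    WeylAlgebra K →ₐ[K] WeylRing K :=
  RingQuot.liftAlgHom K
    ⟨FreeAlgebra.lift K ![(2⁻¹ : K) • WeylRing.u K - WeylRing.v K,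
      (2⁻¹ : K) • WeylRing.u K + WeylRing.v K], by
      rintro _ _ ⟨⟩
      simp only [map_mul, map_add, map_one, FreeAlgebra.lift_ι_apply, Matrix.cons_val_zero,
        Matrix.cons_val_one, add_mul, mul_sub, sub_mul, mul_add, smul_mul_assoc, mul_smul_comm,
        WeylRing.v_mul_u, smul_add]
      module⟩

theorem toWeylRing_X : toWeylRing K (X K) = (2⁻¹ : K) • WeylRing.u K - WeylRing.v K := by
  simp [toWeylRing, X]

theorem toWeylRing_Y : toWeylRing K (Y K) = (2⁻¹ : K) • WeylRing.u K + WeylRing.v K := by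
  simp [toWeylRing, Y]

/-- The inverse coordinate change `u ↦ X + Y`, `v ↦ (Y - X) / 2`. -/
noncomputable def ofWeylRing (K : Type*) [Field K] [CharZero K] :
    WeylRing K →ₐ[K] WeylAlgebra K :=
  WeylRing.lift (X K + Y K) ((2⁻¹ : K) • Y K + (-2⁻¹ : K) • X K) (by
    simp only [add_mul, mul_add, smul_mul_assoc, mul_smul_comm, Y_mul_X, smul_add]
    module)

/-- The Weyl algebra in the coordinates `u = X + Y` and `v = (Y - X) / 2`. -/
noncomputable def equivWeylRing (K : Type*) [Field K] [CharZero K] :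
    WeylAlgebra K ≃ₐ[K] WeylRing K :=
  AlgEquiv.ofAlgHom (toWeylRing K) (ofWeylRing K)
    (by
      apply WeylRing.algHom_ext
      · simp only [AlgHom.comp_apply, ofWeylRing, WeylRing.lift_u, map_add, toWeylRing_X,
          toWeylRing_Y, AlgHom.id_apply]
        module
      · simp only [AlgHom.comp_apply, ofWeylRing, WeylRing.lift_v, map_add, map_smul, toWeylRing_X,
          toWeylRing_Y, AlgHom.id_apply]
        module)
    (by
      apply algHom_ext
      · simp only [AlgHom.comp_apply, toWeylRing_X, map_sub, map_smul, ofWeylRing,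
          WeylRing.lift_u, WeylRing.lift_v, AlgHom.id_apply]
        module
      · simp only [AlgHom.comp_apply, toWeylRing_Y, map_add, map_smul, ofWeylRing,
          WeylRing.lift_u, WeylRing.lift_v, AlgHom.id_apply]
        module)

theorem equivWeylRing_alpha (a : WeylAlgebra K) :
    equivWeylRing K (alpha K a) = (WeylRing.flip (equivWeylRing K a)).unop := by
  have h : (AlgHom.op (toWeylRing K)).comp (alphaOp K) = WeylRing.flip.comp (toWeylRing K) := by
    apply algHom_ext
    · change MulOpposite.op (toWeylRing K (alpha K (X K))) = WeylRing.flip (toWeylRing K (X K))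
      rw [alpha_X, toWeylRing_X, toWeylRing_Y]
      simp [WeylRing.flip]
    · change MulOpposite.op (toWeylRing K (alpha K (Y K))) = WeylRing.flip (toWeylRing K (Y K))
      rw [alpha_Y, toWeylRing_X, toWeylRing_Y]
      simp [WeylRing.flip, sub_eq_add_neg]
  exact congr_arg MulOpposite.unop (DFunLike.congr_fun h a)

/-- An endomorphism commuting with the exchange involution is an automorphism. -/
theorem bijective_of_alpha_comm (f : WeylAlgebra K →ₐ[K] WeylAlgebra K)
    (hf : ∀ a, f (alpha K a) = alpha K (f a)) : Function.Bijective f := by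
  let e := equivWeylRing K
  let F : WeylRing K →ₐ[K] WeylRing K := (e.toAlgHom.comp f).comp e.symm.toAlgHom
  have hF : Function.Bijective F := by
    refine WeylRing.bijective_of_flip_comm F fun a => ?_
    obtain ⟨b, rfl⟩ := e.surjective a
    have h1 : ∀ x, F (e x) = e (f x) := fun x => congr_arg (fun y => e (f y)) (e.symm_apply_apply x)
    rw [← equivWeylRing_alpha, h1, h1, hf, equivWeylRing_alpha]
  have h : (f : WeylAlgebra K → WeylAlgebra K) = e.symm ∘ F ∘ e := by
    funext x
    simp [F]
  rw [h]
  exact e.symm.bijective.comp (hF.comp e.bijective)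

/-- If g and h conjugate γ and δ to α, then h ∘ f ∘ g⁻¹ commutes with α. -/
theorem bijective_of_isInvolutiveEndomorphism {γ δ : WeylAlgebra K →ₗ[K] WeylAlgebra K}
    (hγ : IsConjugateToAlpha γ) (hδ : IsConjugateToAlpha δ) {f : WeylAlgebra K →ₐ[K] WeylAlgebra K}
    (hf : IsInvolutiveEndomorphism γ δ f) : Function.Bijective f := by
  obtain ⟨g, hg⟩ := hγ.exists_algEquiv
  obtain ⟨h, hh⟩ := hδ.exists_algEquiv
  let F : WeylAlgebra K →ₐ[K] WeylAlgebra K := (h.toAlgHom.comp f).comp g.symm.toAlgHom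
  have hFg : ∀ x, F (g x) = h (f x) := fun x => congr_arg (fun y => h (f y)) (g.symm_apply_apply x)
  have hF : Function.Bijective F := by
    refine bijective_of_alpha_comm F fun a => ?_
    obtain ⟨b, rfl⟩ := g.surjective a
    rw [← hg, hFg, hFg, hf, hh]
  have e : (f : WeylAlgebra K → WeylAlgebra K) = h.symm ∘ F ∘ g := by
    funext x
    rw [Function.comp_apply, Function.comp_apply, hFg, AlgEquiv.symm_apply_apply]
  rw [e]
  exact h.symm.bijective.comp (hF.comp g.bijective)

end

end WeylAlgebra

theorem mainTheorem10 (K : Type*) [Field K] [CharZero K]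
    (hconj : ∀ γ : WeylAlgebra K →ₗ[K] WeylAlgebra K,
      WeylAlgebra.IsInvolution γ → WeylAlgebra.IsConjugateToAlpha γ) :
    (∀ γ δ : WeylAlgebra K →ₗ[K] WeylAlgebra K,
      WeylAlgebra.IsInvolution γ → WeylAlgebra.IsInvolution δ →
      ∀ f : WeylAlgebra K →ₐ[K] WeylAlgebra K,
        WeylAlgebra.IsInvolutiveEndomorphism γ δ f → Function.Bijective f) ∧
    (WeylAlgebra.DixmierConjecture K ↔ WeylAlgebra.GammaDeltaConjecture K) := by
  have h1 : ∀ γ δ : WeylAlgebra K →ₗ[K] WeylAlgebra K,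
      WeylAlgebra.IsInvolution γ → WeylAlgebra.IsInvolution δ →
      ∀ f : WeylAlgebra K →ₐ[K] WeylAlgebra K,
        WeylAlgebra.IsInvolutiveEndomorphism γ δ f → Function.Bijective f :=
    fun γ δ hγ hδ f hf =>
      WeylAlgebra.bijective_of_isInvolutiveEndomorphism (hconj γ hγ) (hconj δ hδ) hf
  refine ⟨h1, fun h f => WeylAlgebra.exists_involutions_of_bijective f (h f), fun h f => ?_⟩
  obtain ⟨γ, δ, hγ, hδ, hf⟩ := h f
  exact h1 γ δ hγ hδ f hf
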